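/- All manifolds are smooth, finite-dimensional, Hausdorff and second countable; all vector bundles are smooth, real and of finite rank; sections and maps are smooth. A double vector bundle $(D;A,B;M)$ is a manifold $D$ with two vector bundle structures $\pi_A\colon D\to A$ and $\pi_B\colon D\to B$ over the total spaces of vector bundles $q_A\colon A\to M$, $q_B\colon B\to M$, such that $q_A\circ\pi_A=q_B\circ\pi_B$, and such that $\pi_B$, the addition and the scalar multiplication of $D\to B$ are vector bundle morphisms over $q_A$, the addition and the scalar multiplication of $A\to M$. Its core is $C=\{d\in D:\pi_A(d)=0,\ \pi_B(d)=0\}$, a vector bundle over $M$. A morphism of double vector bundles is a map $D_1\to D_2$ that is a vector bundle morphism for both structures, over vector bundle morphisms of the sides that lie over the same map $M_1\to M_2$. An involutive double vector bundle $(D;Q,Q;M)$, with projections $\pi_1,\pi_2\colon D\to Q$, is a double vector bundle with a map $\mathcal I\colon D\to D$, $\mathcal I^2=\mathrm{Id}$, that is a vector bundle morphism over $\mathrm{Id}_Q$ from $\pi_1$ to $\pi_2$ and from $\pi_2$ to $\pi_1$ and restricts to $-\mathrm{Id}$ on the core. A morphism of involutive double vector bundles $\Omega\colon D_1\to D_2$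 is a morphism of double vector bundles with $\Omega\circ\mathcal I_1=\mathcal I_2\circ\Omega$; it lies over a vector bundle morphism $\omega_Q\colon Q_1\to Q_2$ (the map induced through $\pi_1$) over a smooth map $\omega_0\colon M_1\to M_2$. For an involutive double vector bundle $D$, let $\mathbb E=D^*_{\pi_1}\to Q$ be the dual of $\pi_1\colon D\to Q$, and let $B$ be the dual of the core of $D$. Then $\mathbb E$ is a double vector bundle with sides $Q$ and $B$: an element $\Phi\in\mathbb E$ over $q\in Q_m$ projects to the form $c\mapsto\Phi(0_q+_2c)$ in $B_m$, and the addition over $B$ is given by $(\Phi_1+_B\Phi_2)(d_1+_2d_2)=\Phi_1(d_1)+\Phi_2(d_2)$. It has the linear metric $\langle e_1,e_2\rangle=e_1(d)+e_2(\mathcal I(d))$ for $e_1,e_2\in\mathbb E$ over the same point of $B$ and any $d\in D$ with $\pi_1(d)$, $\pi_2(d)$ the projections of $e_1$, $e_2$ to $Q$. A section of $\mathbb E\to Q$ is linear if it is a vector bundle morphism from $Q\to M$ to $\mathbb E\to B$ over a section of $B\to M$. Let $\mathcal C(\mathbb E)$ be the set of linear sections of $\mathbb E\to Q$ with isotropic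 image; it is a $C^\infty(M)$-module, $f$ acting by multiplication with $q_Q^*f$. For $\tau_1,\tau_2\in\Gamma(Q^*)$ let $\tau_1\wedge\tau_2=\frac12(\tau_1\otimes\tau_2-\tau_2\otimes\tau_1)$, and let $\widetilde{\tau_1\wedge\tau_2}\in\mathcal C(\mathbb E)$ be the section with $\langle\widetilde{\tau_1\wedge\tau_2},d\rangle=(\tau_1\wedge\tau_2)(\pi_1(d),\pi_2(d))$ for $d\in D$. **Theorem.** Let $(D_1;Q_1,Q_1;M_1)$ and $(D_2;Q_2,Q_2;M_2)$ be involutive double vector bundles, with duals $\mathbb E_1$ and $\mathbb E_2$ as above. A morphism $\Omega\colon D_1\to D_2$ of involutive double vector bundles is equivalent to a smooth map $\omega_0\colon M_1\to M_2$ with a pair of morphisms of modules over $\omega_0^*\colon C^\infty(M_2)\to C^\infty(M_1)$, $$\omega^\star\colon\mathcal C(\mathbb E_2)\to\mathcal C(\mathbb E_1),\qquad \omega_Q^\star\colon\Gamma(Q_2^*)\to\Gamma(Q_1^*),$$ such that $\omega^\star(\widetilde{\tau_1\wedge\tau_2})=\widetilde{\omega_Q^\star\tau_1\wedge\omega_Q^\star\tau_2}$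 for all $\tau_1,\tau_2\in\Gamma(Q_2^*)$. Precisely: each morphism $\Omega$, over $\omega_Q$ and $\omega_0$, induces exactly one such triple $(\omega_0,\omega^\star,\omega_Q^\star)$, where $\omega_0$ is the base map of $\Omega$ and $$\langle\omega^\star\chi,d\rangle=\langle\chi,\Omega(d)\rangle,\qquad \langle\omega_Q^\star\tau,q\rangle=\langle\tau,\omega_Q(q)\rangle$$ for all $\chi\in\mathcal C(\mathbb E_2)$, $d\in D_1$, $\tau\in\Gamma(Q_2^*)$, $q\in Q_1$; and each such triple is induced by exactly one morphism $\Omega$. -/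

import Mathlib

open Bundle Manifold ContDiff

universe u v
noncomputable section

/-- A smooth real vector bundle of finite rank over the manifold `M`: a bundled version of Mathlib's
smooth vector bundles, with model fibre `F` and fibres `Fib m`. -/
structure SmoothVB {E H : Type*} [NormedAddCommGroup E] [NormedSpace ℝ E] [TopologicalSpace H]
    (I : ModelWithCorners ℝ E H) (M : Type u) [TopologicalSpace M] [ChartedSpace H M] where
  F : Type
  [normedF : NormedAddCommGroup F]
  [spaceF : NormedSpace ℝ F]
  [finF : FiniteDimensional ℝ F]
  Fib : M → Type u
  [topTot : TopologicalSpace (TotalSpace F Fib)]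
  [topFib : ∀ x, TopologicalSpace (Fib x)]
  [addFib : ∀ x, AddCommGroup (Fib x)]
  [modFib : ∀ x, Module ℝ (Fib x)]
  [fiberBundle : FiberBundle F Fib]
  [vectorBundle : VectorBundle ℝ F Fib]
  [contMDiff : ContMDiffVectorBundle ∞ F Fib I]

namespace SmoothVB

attribute [instance] normedF spaceF finF topTot topFib addFib modFib fiberBundle vectorBundle
  contMDiff

variable {E H : Type*} [NormedAddCommGroup E] [NormedSpace ℝ E] [TopologicalSpace H]
  {I : ModelWithCorners ℝ E H} {M : Type u} [TopologicalSpace M] [ChartedSpace H M]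

/-- The total space, with the smooth manifold structure that Mathlib puts on it. -/
abbrev Tot (V : SmoothVB I M) : Type _ := TotalSpace V.F V.Fib

/-- The smooth (global) sections. -/
abbrev Sec (V : SmoothVB I M) : Type _ := Cₛ^∞⟮I; V.F, V.Fib⟯

/-- The dual vector bundle (Mathlib's smooth bundle of continuous linear maps to `ℝ`). -/
@[reducible] def dual (V : SmoothVB I M) : SmoothVB I M where
  F := V.F →L[ℝ] ℝ
  Fib := fun m => V.Fib m →L[ℝ] Trivial M ℝ m

/-- Fibrewise addition on the total space; only meaningful for elements of the same fibre. -/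
def tadd {V : SmoothVB I M} (x y : V.Tot) : V.Tot :=
  open Classical in
  if h : y.proj = x.proj then ⟨x.proj, x.2 + h ▸ y.2⟩ else x

/-- Fibrewise scalar multiplication on the total space. -/
def tsmul {V : SmoothVB I M} (t : ℝ) (x : V.Tot) : V.Tot := ⟨x.proj, t • x.2⟩

/-- The zero section. -/
def tzero (V : SmoothVB I M) (m : M) : V.Tot := ⟨m, 0⟩

@[simp] theorem tadd_mk {V : SmoothVB I M} (m : M) (u v : V.Fib m) :
    tadd (⟨m, u⟩ : V.Tot) ⟨m, v⟩ = ⟨m, u + v⟩ := by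
  simp [tadd]

/-- The fibrewise linear function `ℓ_s`, `x ↦ ⟨s (proj x), x⟩`, of a section `s` of the dual. -/
def linFun {V : SmoothVB I M} (s : V.dual.Sec) (x : V.Tot) : ℝ := s x.proj x.2

/-- A family of linear forms is a smooth section of the dual if its linear function is smooth. -/
theorem dual_contMDiff {V : SmoothVB I M} (s : ∀ m, V.dual.Fib m)
    (h : ContMDiff (I.prod 𝓘(ℝ, V.F)) 𝓘(ℝ, ℝ) ∞ (fun x : V.Tot => s x.proj x.2)) :
    ContMDiff I (I.prod 𝓘(ℝ, V.F →L[ℝ] ℝ)) ∞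
      (fun m => (⟨m, s m⟩ : V.dual.Tot)) := by
  intro m₀
  rw [contMDiffAt_totalSpace]
  refine ⟨contMDiffAt_id, ?_⟩
  let b := Module.finBasis ℝ V.F
  let e := trivializationAt V.F V.Fib m₀
  have key : ∀ m ∈ e.baseSet, (trivializationAt (V.F →L[ℝ] ℝ)
      (fun m => V.Fib m →L[ℝ] Trivial M ℝ m) m₀ ⟨m, s m⟩).2 =
      ∑ i, (s m (e.symm m (b i))) • LinearMap.toContinuousLinearMap (b.coord i) := by
    intro m hm
    rw [hom_trivializationAt_apply]
    ext v
    simp only [ContinuousLinearMap.inCoordinates]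
    have hv : v = ∑ i, b.repr v i • b i := (b.sum_repr v).symm
    have : ∀ w, e.symm m w = e.symmL ℝ m w := fun w => by rw [Trivialization.symmL_apply e hm]
    simp only [this, sum_apply, smul_apply]
    conv_lhs => rw [hv]
    simp only [map_sum, map_smul]
    simp [e, Trivial.continuousLinearMapAt_trivialization, mul_comm]
  have hsm : ContMDiffAt I 𝓘(ℝ, V.F →L[ℝ] ℝ) ∞
      (fun m => ∑ i, (s m (e.symm m (b i))) • LinearMap.toContinuousLinearMap (b.coord i)) m₀ := by
    refine ContMDiffAt.sum fun i _ => ?_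
    suffices hs : ContMDiffAt I 𝓘(ℝ, ℝ) ∞ (fun m => s m (e.symm m (b i))) m₀ from
      hs.smul contMDiffAt_const
    have hm₀ : m₀ ∈ e.baseSet := FiberBundle.mem_baseSet_trivializationAt' m₀
    have h1 := (e.contMDiffOn_symm (IB := I) (n := ∞))
    have h2 : ContMDiffAt I (I.prod 𝓘(ℝ, V.F)) ∞
        (fun m => e.toOpenPartialHomeomorph.symm (m, b i)) m₀ := by
      have h3 := h1.contMDiffAt (x := (m₀, b i))
        (e.open_target.mem_nhds (by rw [e.mem_target]; exact hm₀))
      exact h3.comp m₀ (contMDiffAt_id.prodMk contMDiffAt_const)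
    have h4 := (h _).comp m₀ h2
    refine h4.congr_of_eventuallyEq ?_
    filter_upwards [e.open_baseSet.mem_nhds hm₀] with m hm
    have : e.toOpenPartialHomeomorph.symm (m, b i) = ⟨m, e.symm m (b i)⟩ :=
      (e.mk_symm hm (b i)).symm
    exact congrArg (fun x : V.Tot => s x.proj x.2) this.symm
  refine hsm.congr_of_eventuallyEq ?_
  filter_upwards [e.open_baseSet.mem_nhds (FiberBundle.mem_baseSet_trivializationAt' m₀)] with m hm
  exact key m hm

/-- The section of the dual bundle defined by a smooth fibrewise linear function. -/
def secOfFun {V : SmoothVB I M} (g : V.Tot → ℝ)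
    (h : ContMDiff (I.prod 𝓘(ℝ, V.F)) 𝓘(ℝ, ℝ) ∞ g)
    (hadd : ∀ m (u v : V.Fib m), g ⟨m, u + v⟩ = g ⟨m, u⟩ + g ⟨m, v⟩)
    (hsmul : ∀ m (t : ℝ) (u : V.Fib m), g ⟨m, t • u⟩ = t * g ⟨m, u⟩) : V.dual.Sec where
  toFun m :=
    { toFun := fun u => g ⟨m, u⟩
      map_add' := hadd m
      map_smul' := hsmul m
      cont := h.continuous.comp (FiberBundle.continuous_totalSpaceMk V.F V.Fib m) }
  contMDiff_toFun := dual_contMDiff _ h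

theorem linFun_contMDiff {V : SmoothVB I M} (s : V.dual.Sec) :
    ContMDiff (I.prod 𝓘(ℝ, V.F)) 𝓘(ℝ, ℝ) ∞ (linFun s) := by
  have h1 : ContMDiff (I.prod 𝓘(ℝ, V.F)) (I.prod 𝓘(ℝ, V.F →L[ℝ] ℝ)) ∞
      (fun x : V.Tot => (⟨x.proj, s x.proj⟩ : V.dual.Tot)) :=
    s.contMDiff.comp (contMDiff_proj V.Fib)
  have h2 : ContMDiff (I.prod 𝓘(ℝ, V.F)) (I.prod 𝓘(ℝ, V.F)) ∞
      (fun x : V.Tot => TotalSpace.mk' V.F x.proj x.2) := contMDiff_id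
  have h3 := ContMDiff.clm_bundle_apply (E₂ := Trivial M ℝ) (F₂ := ℝ) h1 h2
  intro x
  exact (contMDiffAt_totalSpace.1 (h3 x)).2

/-- The value `⟨⟨Φ, x⟩⟩` of a point `Φ` of the dual bundle on a point `x` of the bundle;
only meaningful if both lie over the same base point. -/
def ev {V : SmoothVB I M} (Φ : V.dual.Tot) (x : V.Tot) : ℝ :=
  open Classical in
  if h : x.proj = Φ.proj then Φ.2 (h ▸ x.2) else 0

/-- The value of a section, as a point of the total space. -/
def pt {V : SmoothVB I M} (s : V.Sec) (m : M) : V.Tot := ⟨m, s m⟩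

theorem tsmul_mk {V : SmoothVB I M} (t : ℝ) (m : M) (u : V.Fib m) :
    tsmul t (⟨m, u⟩ : V.Tot) = ⟨m, t • u⟩ := rfl

theorem tsmul_tzero {V : SmoothVB I M} (t : ℝ) (m : M) : tsmul t (tzero V m) = tzero V m := by
  rw [tzero, tsmul_mk, smul_zero]

theorem tadd_tzero_tzero {V : SmoothVB I M} (m : M) :
    tadd (tzero V m) (tzero V m) = tzero V m := by
  rw [tzero, tadd_mk, add_zero]

theorem zero_tsmul {V : SmoothVB I M} (x : V.Tot) : tsmul 0 x = tzero V x.proj := by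
  rw [tsmul, zero_smul]
  rfl

theorem ev_mk {V : SmoothVB I M} (m : M) (φ : V.dual.Fib m) (x : V.Fib m) :
    ev (⟨m, φ⟩ : V.dual.Tot) ⟨m, x⟩ = φ x := by
  simp [ev]

theorem ev_pt {V : SmoothVB I M} (s : V.dual.Sec) (x : V.Tot) :
    ev (pt s x.proj) x = linFun s x :=
  ev_mk x.proj (s x.proj) x.2

theorem ev_tadd {V : SmoothVB I M} (Φ : V.dual.Tot) (x y : V.Tot) (hx : x.proj = Φ.proj)
    (hy : y.proj = Φ.proj) : ev Φ (tadd x y) = ev Φ x + ev Φ y := by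
  obtain ⟨m, φ⟩ := Φ
  obtain ⟨k, x⟩ := x
  obtain ⟨l, y⟩ := y
  obtain rfl : k = m := hx
  obtain rfl : l = k := hy
  rw [tadd_mk, ev_mk, ev_mk, ev_mk]
  exact φ.map_add x y

theorem ev_tsmul {V : SmoothVB I M} (Φ : V.dual.Tot) (t : ℝ) (x : V.Tot) (hx : x.proj = Φ.proj) :
    ev Φ (tsmul t x) = t * ev Φ x := by
  obtain ⟨m, φ⟩ := Φ
  obtain ⟨k, x⟩ := x
  obtain rfl : k = m := hx
  rw [tsmul, ev_mk, ev_mk]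
  exact φ.map_smul t x

/-- Sections form a module over the smooth functions on the base. -/
instance secModule {F : Type*} [NormedAddCommGroup F] [NormedSpace ℝ F] {V : M → Type*}
    [TopologicalSpace (TotalSpace F V)] [∀ x, TopologicalSpace (V x)] [FiberBundle F V]
    [∀ x, AddCommGroup (V x)] [∀ x, Module ℝ (V x)] [VectorBundle ℝ F V] :
    Module C^∞⟮I, M; ℝ⟯ Cₛ^∞⟮I; F, V⟯ where
  smul f s := ⟨fun m => f m • s m, f.contMDiff.smul_section s.contMDiff⟩
  one_smul s := by ext m; exact one_smul ℝ (s m)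
  mul_smul f g s := by ext m; exact mul_smul (f m) (g m) (s m)
  smul_zero f := by ext m; exact smul_zero (f m)
  smul_add f s t := by ext m; exact smul_add (f m) (s m) (t m)
  add_smul f g s := by ext m; exact add_smul (f m) (g m) (s m)
  zero_smul s := by ext m; exact zero_smul ℝ (s m)

theorem ev_pt_add {V : SmoothVB I M} (s t : V.dual.Sec) (m : M) (x : V.Tot) :
    ev (pt (s + t) m) x = ev (pt s m) x + ev (pt t m) x := by
  unfold ev pt
  split_ifs with h
  · rfl
  · simp

theorem ev_pt_zero {V : SmoothVB I M} (m : M) (x : V.Tot) :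
    ev (pt (0 : V.dual.Sec) m) x = 0 := by
  unfold ev pt
  split_ifs with h <;> rfl

theorem ev_pt_smul {V : SmoothVB I M} (f : C^∞⟮I, M; ℝ⟯) (s : V.dual.Sec) (m : M) (x : V.Tot) :
    ev (pt (f • s) m) x = f m * ev (pt s m) x := by
  unfold ev pt
  split_ifs with h
  · rfl
  · simp

theorem ev_pt_neg {V : SmoothVB I M} (s : V.dual.Sec) (m : M) (x : V.Tot) :
    ev (pt (-s) m) x = - ev (pt s m) x := by
  unfold ev pt
  split_ifs with h
  · rfl
  · simp

theorem tadd_proj {V : SmoothVB I M} (x y : V.Tot) : (tadd x y).proj = x.proj := by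
  unfold tadd
  split_ifs <;> rfl

theorem tadd_tzero {V : SmoothVB I M} (x : V.Tot) : tadd x (tzero V x.proj) = x := by
  obtain ⟨m, x⟩ := x
  simp [tzero]

theorem linFun_tadd {V : SmoothVB I M} (s : V.dual.Sec) (x y : V.Tot) (h : x.proj = y.proj) :
    linFun s (tadd x y) = linFun s x + linFun s y := by
  have := ev_tadd (pt s x.proj) x y rfl h.symm
  rw [ev_pt] at this
  rw [← ev_pt, tadd_proj, this, h, ev_pt]

theorem linFun_tsmul {V : SmoothVB I M} (s : V.dual.Sec) (t : ℝ) (x : V.Tot) :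
    linFun s (tsmul t x) = t * linFun s x :=
  (s x.proj).map_smul t x.2

theorem linFun_tzero {V : SmoothVB I M} (s : V.dual.Sec) (m : M) :
    linFun s (tzero V m) = 0 :=
  (s m).map_zero

end SmoothVB

/-- The ring morphism `φ^* : C^∞(N) → C^∞(M)` of a smooth map `φ : M → N`. -/
def pullbackFun {E H : Type*} [NormedAddCommGroup E] [NormedSpace ℝ E] [TopologicalSpace H]
    {I : ModelWithCorners ℝ E H} {M : Type u} [TopologicalSpace M] [ChartedSpace H M]
    {E' H' : Type*} [NormedAddCommGroup E'] [NormedSpace ℝ E'] [TopologicalSpace H']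
    {J : ModelWithCorners ℝ E' H'} {N : Type v} [TopologicalSpace N] [ChartedSpace H' N]
    (φ : C^∞⟮I, M; J, N⟯) : C^∞⟮J, N; ℝ⟯ →+* C^∞⟮I, M; ℝ⟯ where
  toFun f := f.comp φ
  map_one' := rfl
  map_mul' _ _ := rfl
  map_zero' := rfl
  map_add' _ _ := rfl

/-- `Ψ` is a morphism of smooth vector bundles over the smooth map `f`. -/
structure IsVBMorphism {E H : Type*} [NormedAddCommGroup E] [NormedSpace ℝ E] [TopologicalSpace H]
    {I : ModelWithCorners ℝ E H} {M : Type u} [TopologicalSpace M] [ChartedSpace H M]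
    {E' H' : Type*} [NormedAddCommGroup E'] [NormedSpace ℝ E'] [TopologicalSpace H']
    {J : ModelWithCorners ℝ E' H'} {N : Type v} [TopologicalSpace N] [ChartedSpace H' N]
    (V : SmoothVB I M) (W : SmoothVB J N) (Ψ : V.Tot → W.Tot) (f : M → N) : Prop where
  smooth : ContMDiff (I.prod 𝓘(ℝ, V.F)) (J.prod 𝓘(ℝ, W.F)) ∞ Ψ
  smooth_base : ContMDiff I J ∞ f
  proj : ∀ x, (Ψ x).proj = f x.proj
  map_add : ∀ x y : V.Tot, x.proj = y.proj →
    Ψ (SmoothVB.tadd x y) = SmoothVB.tadd (Ψ x) (Ψ y)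
  map_smul : ∀ (t : ℝ) (x : V.Tot), Ψ (SmoothVB.tsmul t x) = SmoothVB.tsmul t (Ψ x)

open SmoothVB

section
variable {n : ℕ} {M : Type u} [TopologicalSpace M] [ChartedSpace (EuclideanSpace ℝ (Fin n)) M]

/-- A smooth manifold `D` with two vector bundle structures, over the total spaces of the vector
bundles `A` and `B` on `M`. The manifold `D` is the total space of the first one, and is identified
with the total space of the second one by the diffeomorphism `ident`. -/
structure DoubleBundle (A B : SmoothVB (𝓡 n) M) where
  over₁ : SmoothVB ((𝓡 n).prod 𝓘(ℝ, A.F)) A.Tot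
  over₂ : SmoothVB ((𝓡 n).prod 𝓘(ℝ, B.F)) B.Tot
  ident : Diffeomorph (((𝓡 n).prod 𝓘(ℝ, A.F)).prod 𝓘(ℝ, over₁.F))
    (((𝓡 n).prod 𝓘(ℝ, B.F)).prod 𝓘(ℝ, over₂.F)) over₁.Tot over₂.Tot ∞

namespace DoubleBundle
variable {A B : SmoothVB (𝓡 n) M} (D : DoubleBundle A B)

/-- The manifold `D`. -/
abbrev Tot : Type _ := D.over₁.Tot
variable {D}
/-- The projection `D → A`. -/
def π₁ (d : D.Tot) : A.Tot := d.proj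
/-- The projection `D → B`. -/
def π₂ (d : D.Tot) : B.Tot := (D.ident d).proj
/-- The addition in the fibres of `D → A`. -/
def add₁ (x y : D.Tot) : D.Tot := tadd x y
/-- The scalar multiplication in the fibres of `D → A`. -/
def smul₁ (t : ℝ) (d : D.Tot) : D.Tot := tsmul t d
/-- The addition in the fibres of `D → B`. -/
def add₂ (x y : D.Tot) : D.Tot := D.ident.symm (tadd (D.ident x) (D.ident y))
/-- The scalar multiplication in the fibres of `D → B`. -/
def smul₂ (t : ℝ) (d : D.Tot) : D.Tot := D.ident.symm (tsmul t (D.ident d))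
variable (D)
/-- The zero section of `D → A`. -/
def zero₁ (a : A.Tot) : D.Tot := tzero D.over₁ a
end DoubleBundle

open DoubleBundle

/-- A double vector bundle `(D; A, B; M)`: the square of projections commutes, `D → B` is a vector
bundle morphism over `A → M` (`proj₂`), the addition of `D → B` is a vector bundle morphism over the
addition of `A` (`π₁_add₂`, `interchange`, `add₂_smul₁`), and the scalar multiplication of `D → B` is
a vector bundle morphism over that of `A` (`π₁_smul₂`, `smul₂_add₁`, `smul₂_smul₁`). -/
structure DoubleVectorBundle (A B : SmoothVB (𝓡 n) M) extends DoubleBundle A B where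
  square : ∀ d : toDoubleBundle.Tot, (π₁ d).proj = (π₂ d).proj
  proj₂ : IsVBMorphism over₁ B (π₂ (D := toDoubleBundle)) TotalSpace.proj
  π₁_add₂ : ∀ d d' : toDoubleBundle.Tot, π₂ d = π₂ d' →
    π₁ (add₂ d d') = tadd (π₁ d) (π₁ d')
  interchange : ∀ d₁ d₂ d₃ d₄ : toDoubleBundle.Tot, π₁ d₁ = π₁ d₂ → π₁ d₃ = π₁ d₄ →
    π₂ d₁ = π₂ d₃ → π₂ d₂ = π₂ d₄ →
    add₂ (add₁ d₁ d₂) (add₁ d₃ d₄) = add₁ (add₂ d₁ d₃) (add₂ d₂ d₄)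
  add₂_smul₁ : ∀ (t : ℝ) (d d' : toDoubleBundle.Tot), π₂ d = π₂ d' →
    add₂ (smul₁ t d) (smul₁ t d') = smul₁ t (add₂ d d')
  π₁_smul₂ : ∀ (t : ℝ) (d : toDoubleBundle.Tot), π₁ (smul₂ t d) = tsmul t (π₁ d)
  smul₂_add₁ : ∀ (t : ℝ) (d d' : toDoubleBundle.Tot), π₁ d = π₁ d' →
    smul₂ t (add₁ d d') = add₁ (smul₂ t d) (smul₂ t d')
  smul₂_smul₁ : ∀ (t s : ℝ) (d : toDoubleBundle.Tot),
    smul₂ t (smul₁ s d) = smul₁ s (smul₂ t d)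

namespace DoubleVectorBundle
variable {A B : SmoothVB (𝓡 n) M} (D : DoubleVectorBundle A B)

theorem π₂_zero₁ (a : A.Tot) : π₂ (D.zero₁ a) = tzero B a.proj := by
  have h := D.proj₂.map_smul 0 (D.zero₁ a)
  have hp : (π₂ (D.zero₁ a)).proj = a.proj := D.proj₂.proj _
  rw [zero_tsmul, zero_tsmul, hp] at h
  exact h

theorem π₂_add₁ (d d' : D.Tot) (h : π₁ d = π₁ d') :
    π₂ (add₁ d d') = tadd (π₂ d) (π₂ d') := D.proj₂.map_add d d' h

theorem π₂_add₂ (d d' : D.Tot) : π₂ (add₂ d d') = π₂ d := by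
  simp [π₂, add₂, tadd_proj]

theorem π₂_smul₂ (t : ℝ) (d : D.Tot) : π₂ (smul₂ t d) = π₂ d := by
  simp [π₂, smul₂, tsmul]

/-- The fibre over `m` of the core: the elements of `D` over `0 ∈ A_m` and over `0 ∈ B_m`. -/
def coreFib (m : M) : Submodule ℝ (D.over₁.Fib (tzero A m)) where
  carrier := {x | π₂ (⟨tzero A m, x⟩ : D.Tot) = tzero B m}
  add_mem' {x y} hx hy := by
    have h := D.π₂_add₁ (⟨tzero A m, x⟩ : D.Tot) ⟨tzero A m, y⟩ rfl
    have hx' : π₂ (⟨tzero A m, x⟩ : D.Tot) = tzero B m := hx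
    have hy' : π₂ (⟨tzero A m, y⟩ : D.Tot) = tzero B m := hy
    rw [hx', hy', tadd_tzero_tzero, add₁, tadd_mk] at h
    exact h
  zero_mem' := D.π₂_zero₁ (tzero A m)
  smul_mem' t x hx := by
    have h := D.proj₂.map_smul t (⟨tzero A m, x⟩ : D.Tot)
    have hx' : π₂ (⟨tzero A m, x⟩ : D.Tot) = tzero B m := hx
    rw [hx', tsmul_tzero, tsmul_mk] at h
    exact h

/-- The inclusion of the core in `D`. -/
def coreIncl {m : M} (c : D.coreFib m) : D.Tot := ⟨tzero A m, c.1⟩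

/-- The element `0^D_a +_B c` of `D`, for `a ∈ A_m` and `c` in the core over `m`. -/
def addCore (a : A.Tot) (c : D.coreFib a.proj) : D.Tot := add₂ (D.zero₁ a) (D.coreIncl c)

theorem π₂_zero_core (a : A.Tot) (c : D.coreFib a.proj) :
    π₂ (D.zero₁ a) = π₂ (D.coreIncl c) :=
  (D.π₂_zero₁ a).trans c.2.symm

theorem π₁_addCore (a : A.Tot) (c : D.coreFib a.proj) : π₁ (D.addCore a c) = a :=
  (D.π₁_add₂ _ _ (D.π₂_zero_core a c)).trans (tadd_tzero a)

theorem addCore_add (a : A.Tot) (c c' : D.coreFib a.proj) :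
    D.addCore a (c + c') = add₁ (D.addCore a c) (D.addCore a c') := by
  have h := D.interchange (D.zero₁ a) (D.zero₁ a) (D.coreIncl c) (D.coreIncl c')
    rfl rfl (D.π₂_zero_core _ c) (D.π₂_zero_core _ c')
  have h1 : add₁ (D.zero₁ a) (D.zero₁ a) = D.zero₁ a := tadd_tzero_tzero a
  have h2 : add₁ (D.coreIncl c) (D.coreIncl c') = D.coreIncl (c + c') := tadd_mk _ _ _
  rw [h1, h2] at h
  exact h

theorem addCore_smul (a : A.Tot) (t : ℝ) (c : D.coreFib a.proj) :
    D.addCore a (t • c) = smul₁ t (D.addCore a c) := by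
  have h := D.add₂_smul₁ t _ _ (D.π₂_zero_core a c)
  have h1 : smul₁ t (D.zero₁ a) = D.zero₁ a := tsmul_tzero t a
  have h2 : smul₁ t (D.coreIncl c) = D.coreIncl (t • c) := rfl
  rw [h1, h2] at h
  exact h

/-- The second projection of the dual double vector bundle `D^*_A`, which has sides `A` and the
dual of the core: `Φ ∈ D^*_A` over `a ∈ A_m` is sent to `c ↦ Φ (0^D_a +_B c)`. -/
def dualProj (Φ : D.over₁.dual.Tot) : Module.Dual ℝ (D.coreFib Φ.proj.proj) where
  toFun c := ev Φ (D.addCore Φ.proj c)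
  map_add' c c' := by
    rw [D.addCore_add]
    exact ev_tadd Φ _ _ (D.π₁_addCore _ c) (D.π₁_addCore _ c')
  map_smul' t c := by
    rw [D.addCore_smul]
    exact ev_tsmul Φ t _ (D.π₁_addCore _ c)

/-- `Φ = Φ₁ +_{C^*} Φ₂`, the addition of elements of `D^*_A` with the same projection to the dual of
the core: `Φ` lies over `a₁ + a₂` and `Φ (d₁ +_B d₂) = Φ₁ d₁ + Φ₂ d₂`. -/
def IsDualAdd (Φ₁ Φ₂ Φ : D.over₁.dual.Tot) : Prop :=
  Φ.proj = tadd Φ₁.proj Φ₂.proj ∧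
    ∀ d₁ d₂ : D.Tot, π₁ d₁ = Φ₁.proj → π₁ d₂ = Φ₂.proj → π₂ d₁ = π₂ d₂ →
      ev Φ (add₂ d₁ d₂) = ev Φ₁ d₁ + ev Φ₂ d₂

/-- `Ψ = t ·_{C^*} Φ`, for elements of `D^*_A` with the same projection to the dual of the core:
`Ψ` lies over `t a` and `Ψ (t ·_B d) = t Φ d`. -/
def IsDualSMul (t : ℝ) (Φ Ψ : D.over₁.dual.Tot) : Prop :=
  Ψ.proj = tsmul t Φ.proj ∧
    ∀ d : D.Tot, π₁ d = Φ.proj → ev Ψ (smul₂ t d) = t * ev Φ d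

/-- The smooth section `χ` of `D^*_A → A` is linear: it is a morphism of vector bundles from `A → M`
to `D^*_A → C^*` over a section `b` of the dual `C^*` of the core `C`. (The section `b` inherits
smoothness from `χ`.) -/
structure IsLinearSection (χ : D.over₁.dual.Sec) : Prop where
  proj : ∃ b : ∀ m, Module.Dual ℝ (D.coreFib m), ∀ a : A.Tot, D.dualProj (pt χ a) = b a.proj
  add : ∀ a a' : A.Tot, a.proj = a'.proj → D.IsDualAdd (pt χ a) (pt χ a') (pt χ (tadd a a'))
  smul : ∀ (t : ℝ) (a : A.Tot), D.IsDualSMul t (pt χ a) (pt χ (tsmul t a))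

end DoubleVectorBundle

/-- An involutive double vector bundle `(D; Q, Q; M)`: the involution is a morphism of double vector
bundles that exchanges the two structures of `D`, is the identity on the sides and minus the identity
on the core. -/
structure InvolutiveDVB (Q : SmoothVB (𝓡 n) M) extends DoubleVectorBundle Q Q where
  inv : toDoubleVectorBundle.Tot → toDoubleVectorBundle.Tot
  inv₁₂ : IsVBMorphism over₁ over₂ (fun d => ident (inv d)) id
  inv₂₁ : IsVBMorphism over₂ over₁ (fun d => inv (ident.symm d)) id
  inv_inv : ∀ d, inv (inv d) = d
  inv_core : ∀ (m : M) (c : toDoubleVectorBundle.coreFib m),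
    inv (toDoubleVectorBundle.coreIncl c) = toDoubleVectorBundle.coreIncl (-c)

namespace InvolutiveDVB
variable {Q : SmoothVB (𝓡 n) M} (D : InvolutiveDVB Q)

theorem π₂_inv (d : D.Tot) : π₂ (D.inv d) = π₁ d := D.inv₁₂.proj d

theorem π₁_inv (d : D.Tot) : π₁ (D.inv d) = π₂ d := by
  have h := D.inv₂₁.proj (D.ident d)
  rwa [D.ident.symm_apply_apply] at h

/-- The dual `𝔼 = D^*_{π₁}`, a vector bundle over `Q`. -/
abbrev dualE : SmoothVB ((𝓡 n).prod 𝓘(ℝ, Q.F)) Q.Tot := D.over₁.dual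

/-- `⟨e₁, e₂⟩ = r` for the linear metric of `𝔼 → B`, `B` the dual of the core of `D`: for
`e₁, e₂ ∈ 𝔼` with the same projection to `B`, the metric is `⟨e₁, e₂⟩ = e₁ d + e₂ (inv d)` for any
`d ∈ D` with `π₁ d` and `π₂ d` the projections to `Q` of `e₁` and `e₂`. -/
def HasMetricValue (e₁ e₂ : D.dualE.Tot) (r : ℝ) : Prop :=
  ∀ d : D.Tot, π₁ d = e₁.proj → π₂ d = e₂.proj → ev e₁ d + ev e₂ (D.inv d) = r

/-- The section `χ` of `𝔼 → Q` has isotropic image. -/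
def IsIsotropic (χ : D.dualE.Sec) : Prop :=
  ∀ q q' : Q.Tot, q.proj = q'.proj → D.HasMetricValue (pt χ q) (pt χ q') 0

/-- `𝒞(𝔼)`: the linear sections of `𝔼 → Q` with isotropic image. -/
def isotropicSections : AddSubgroup D.dualE.Sec where
  carrier := {χ | D.IsLinearSection χ ∧ D.IsIsotropic χ}
  add_mem' := by
    rintro χ χ' ⟨⟨⟨b, hb⟩, ha, hs⟩, hi⟩ ⟨⟨⟨b', hb'⟩, ha', hs'⟩, hi'⟩
    refine ⟨⟨⟨fun m => b m + b' m, fun a => ?_⟩, fun a a' h => ⟨rfl, fun d₁ d₂ h₁ h₂ h₃ => ?_⟩,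
      fun t a => ⟨rfl, fun d h => ?_⟩⟩, fun q q' h d h₁ h₂ => ?_⟩
    · ext c
      have e1 := LinearMap.congr_fun (hb a) c
      have e2 := LinearMap.congr_fun (hb' a) c
      exact (ev_pt_add χ χ' a _).trans (congrArg₂ (· + ·) e1 e2)
    · rw [ev_pt_add, ev_pt_add, ev_pt_add, (ha a a' h).2 d₁ d₂ h₁ h₂ h₃,
        (ha' a a' h).2 d₁ d₂ h₁ h₂ h₃]
      ring
    · rw [ev_pt_add, ev_pt_add, (hs t a).2 d h, (hs' t a).2 d h]
      ring
    · rw [ev_pt_add, ev_pt_add]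
      linarith [hi q q' h d h₁ h₂, hi' q q' h d h₁ h₂]
  zero_mem' := by
    refine ⟨⟨⟨fun m => 0, fun a => ?_⟩, fun a a' h => ⟨rfl, fun d₁ d₂ h₁ h₂ h₃ => ?_⟩,
      fun t a => ⟨rfl, fun d h => ?_⟩⟩, fun q q' h d h₁ h₂ => ?_⟩
    · ext c
      exact ev_pt_zero (V := D.over₁) a _
    · simp only [ev_pt_zero, add_zero]
    · simp only [ev_pt_zero, mul_zero]
    · simp only [ev_pt_zero, add_zero]
  neg_mem' := by
    rintro χ ⟨⟨⟨b, hb⟩, ha, hs⟩, hi⟩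
    refine ⟨⟨⟨fun m => -b m, fun a => ?_⟩, fun a a' h => ⟨rfl, fun d₁ d₂ h₁ h₂ h₃ => ?_⟩,
      fun t a => ⟨rfl, fun d h => ?_⟩⟩, fun q q' h d h₁ h₂ => ?_⟩
    · ext c
      have e1 := LinearMap.congr_fun (hb a) c
      exact (ev_pt_neg χ a _).trans (congrArg Neg.neg e1)
    · rw [ev_pt_neg, ev_pt_neg, ev_pt_neg, (ha a a' h).2 d₁ d₂ h₁ h₂ h₃]
      ring
    · rw [ev_pt_neg, ev_pt_neg, (hs t a).2 d h]
      ring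
    · rw [ev_pt_neg, ev_pt_neg]
      linarith [hi q q' h d h₁ h₂]

/-- The pullback `q_Q^* f` to `Q` of a smooth function `f` on `M`. -/
def pullQ (f : C^∞⟮𝓡 n, M; ℝ⟯) : C^∞⟮(𝓡 n).prod 𝓘(ℝ, Q.F), Q.Tot; ℝ⟯ :=
  f.comp ⟨TotalSpace.proj, contMDiff_proj Q.Fib⟩

theorem pullQ_smul_mem (f : C^∞⟮𝓡 n, M; ℝ⟯) {χ : D.dualE.Sec} (h : χ ∈ D.isotropicSections) :
    pullQ (Q := Q) f • χ ∈ D.isotropicSections := by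
  obtain ⟨⟨⟨b, hb⟩, ha, hs⟩, hi⟩ := h
  have hf : ∀ q : Q.Tot, pullQ (Q := Q) f q = f q.proj := fun _ => rfl
  refine ⟨⟨⟨fun m => f m • b m, fun a => ?_⟩, fun a a' h => ⟨rfl, fun d₁ d₂ h₁ h₂ h₃ => ?_⟩,
    fun t a => ⟨rfl, fun d h => ?_⟩⟩, fun q q' h d h₁ h₂ => ?_⟩
  · ext c
    have e1 := LinearMap.congr_fun (hb a) c
    exact (ev_pt_smul _ χ a _).trans (congrArg (fun r => f a.proj * r) e1)
  · rw [ev_pt_smul, ev_pt_smul, ev_pt_smul, (ha a a' h).2 d₁ d₂ h₁ h₂ h₃, hf, hf, hf, tadd_proj, h]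
    ring
  · rw [ev_pt_smul, ev_pt_smul, (hs t a).2 d h, hf, hf, tsmul]
    ring
  · rw [ev_pt_smul, ev_pt_smul, hf, hf, h, ← mul_add, hi q q' h d h₁ h₂, mul_zero]

/-- `𝒞(𝔼)` is a `C^∞(M)`-module, `f` acting by multiplication with `q_Q^* f`. -/
instance : Module C^∞⟮𝓡 n, M; ℝ⟯ D.isotropicSections where
  smul f χ := ⟨pullQ (Q := Q) f • χ.1, D.pullQ_smul_mem f χ.2⟩
  one_smul χ := Subtype.ext (one_smul _ χ.1)
  mul_smul f g χ := Subtype.ext (mul_smul (pullQ (Q := Q) f) (pullQ (Q := Q) g) χ.1)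
  smul_zero f := Subtype.ext (smul_zero (pullQ (Q := Q) f))
  smul_add f χ χ' := Subtype.ext (smul_add (pullQ (Q := Q) f) χ.1 χ'.1)
  add_smul f g χ := Subtype.ext (add_smul (pullQ (Q := Q) f) (pullQ (Q := Q) g) χ.1)
  zero_smul χ :=
    Subtype.ext (zero_smul C^∞⟮(𝓡 n).prod 𝓘(ℝ, Q.F), Q.Tot; ℝ⟯ χ.1)

/-- The value of the two-form `τ₁ ∧ τ₂ = ½ (τ₁ ⊗ τ₂ - τ₂ ⊗ τ₁)` on `(q, q')`. -/
def wedgeForm (τ₁ τ₂ : Q.dual.Sec) (q q' : Q.Tot) : ℝ :=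
  (1 / 2 : ℝ) * (linFun τ₁ q * linFun τ₂ q' - linFun τ₂ q * linFun τ₁ q')

/-- The core-linear section of `𝔼 → Q` defined by `τ₁ ∧ τ₂`. The core of `𝔼` is the dual of `Q`, with
`τ ∈ Q^*_m` acting on `d ∈ D` over `0 ∈ Q_m` by `⟨τ, π₂ d⟩`. Hence the core-linear section
`q ↦ 0^𝔼_q +_B φ(q)` of a bilinear form `φ` has the value `φ (π₁ d, π₂ d)` on `d`. -/
def wedgeSec (τ₁ τ₂ : Q.dual.Sec) : D.dualE.Sec :=
  secOfFun (fun d : D.Tot => wedgeForm τ₁ τ₂ (π₁ d) (π₂ d))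
    (by
      have hp : ContMDiff (((𝓡 n).prod 𝓘(ℝ, Q.F)).prod 𝓘(ℝ, D.over₁.F))
          ((𝓡 n).prod 𝓘(ℝ, Q.F)) ∞ (fun d : D.Tot => π₁ d) := contMDiff_proj D.over₁.Fib
      have hq := D.proj₂.smooth
      have h1 := (linFun_contMDiff τ₁).comp hp
      have h2 := (linFun_contMDiff τ₂).comp hp
      have h3 := (linFun_contMDiff τ₁).comp hq
      have h4 := (linFun_contMDiff τ₂).comp hq
      exact contMDiff_const.mul ((h1.mul h4).sub (h2.mul h3)))
    (by
      intro q u v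
      have h := D.π₂_add₁ (⟨q, u⟩ : D.Tot) ⟨q, v⟩ rfl
      have hp : (π₂ (⟨q, u⟩ : D.Tot)).proj = (π₂ (⟨q, v⟩ : D.Tot)).proj :=
        (D.proj₂.proj (⟨q, u⟩ : D.Tot)).trans (D.proj₂.proj (⟨q, v⟩ : D.Tot)).symm
      rw [add₁, tadd_mk] at h
      simp only [wedgeForm, h, linFun_tadd _ _ _ hp, π₁]
      ring)
    (by
      intro q t u
      have h : π₂ (⟨q, t • u⟩ : D.Tot) = tsmul t (π₂ (⟨q, u⟩ : D.Tot)) :=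
        D.proj₂.map_smul t (⟨q, u⟩ : D.Tot)
      simp only [wedgeForm, h, linFun_tsmul, π₁]
      ring)

theorem linFun_wedgeSec (τ₁ τ₂ : Q.dual.Sec) (d : D.Tot) :
    linFun (D.wedgeSec τ₁ τ₂) d = wedgeForm τ₁ τ₂ (π₁ d) (π₂ d) := rfl

theorem ev_wedgeSec (τ₁ τ₂ : Q.dual.Sec) (q : Q.Tot) (d : D.Tot) (h : π₁ d = q) :
    ev (pt (D.wedgeSec τ₁ τ₂) q) d = wedgeForm τ₁ τ₂ q (π₂ d) := by
  subst h
  exact (ev_pt (D.wedgeSec τ₁ τ₂) d).trans (D.linFun_wedgeSec τ₁ τ₂ d)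

theorem wedgeSec_mem (τ₁ τ₂ : Q.dual.Sec) : D.wedgeSec τ₁ τ₂ ∈ D.isotropicSections := by
  refine ⟨⟨⟨fun m => 0, fun a => ?_⟩, fun a a' h => ⟨rfl, fun d₁ d₂ h₁ h₂ h₃ => ?_⟩,
    fun t a => ⟨rfl, fun d h => ?_⟩⟩, fun q q' h d h₁ h₂ => ?_⟩
  · ext c
    refine (D.ev_wedgeSec τ₁ τ₂ a _ (D.π₁_addCore a c)).trans ?_
    have h : π₂ (D.addCore a c) = tzero Q a.proj := (D.π₂_add₂ _ _).trans (D.π₂_zero₁ a)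
    simp only [h, wedgeForm, linFun_tzero, mul_zero, sub_zero]
    rfl
  · have h₁' : π₁ d₁ = a := h₁
    have h₂' : π₁ d₂ = a' := h₂
    have h4 : π₁ (add₂ d₁ d₂) = tadd a a' := by rw [D.π₁_add₂ _ _ h₃, h₁', h₂']
    rw [D.ev_wedgeSec _ _ _ _ h4, D.ev_wedgeSec _ _ _ _ h₁', D.ev_wedgeSec _ _ _ _ h₂',
      D.π₂_add₂, ← h₃]
    simp only [wedgeForm, linFun_tadd _ _ _ h]
    ring
  · have h' : π₁ d = a := h
    have h4 : π₁ (smul₂ t d) = tsmul t a := by rw [D.π₁_smul₂, h']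
    rw [D.ev_wedgeSec _ _ _ _ h4, D.ev_wedgeSec _ _ _ _ h', D.π₂_smul₂]
    simp only [wedgeForm, linFun_tsmul]
    ring
  · have h₁' : π₁ d = q := h₁
    have h₂' : π₂ d = q' := h₂
    have h5 : π₁ (D.inv d) = q' := by rw [D.π₁_inv, h₂']
    rw [D.ev_wedgeSec _ _ _ _ h₁', D.ev_wedgeSec _ _ _ _ h5, D.π₂_inv, h₁', h₂']
    simp only [wedgeForm]
    ring

/-- The core-linear section of `τ₁ ∧ τ₂`, as an element of `𝒞(𝔼)`. -/
def wedge (τ₁ τ₂ : Q.dual.Sec) : D.isotropicSections := ⟨D.wedgeSec τ₁ τ₂, D.wedgeSec_mem τ₁ τ₂⟩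

end InvolutiveDVB
end

section
variable {n₁ n₂ : ℕ}
  {M₁ : Type u} [TopologicalSpace M₁] [ChartedSpace (EuclideanSpace ℝ (Fin n₁)) M₁]
  {M₂ : Type v} [TopologicalSpace M₂] [ChartedSpace (EuclideanSpace ℝ (Fin n₂)) M₂]

/-- A morphism of double vector bundles `(D₁; A₁, B₁; M₁) → (D₂; A₂, B₂; M₂)`. -/
structure DVBHom {A₁ B₁ : SmoothVB (𝓡 n₁) M₁} {A₂ B₂ : SmoothVB (𝓡 n₂) M₂}
    (D₁ : DoubleVectorBundle A₁ B₁) (D₂ : DoubleVectorBundle A₂ B₂) where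
  toFun : D₁.Tot → D₂.Tot
  sideA : A₁.Tot → A₂.Tot
  sideB : B₁.Tot → B₂.Tot
  base : M₁ → M₂
  over₁ : IsVBMorphism D₁.over₁ D₂.over₁ toFun sideA
  over₂ : IsVBMorphism D₁.over₂ D₂.over₂ (fun d => D₂.ident (toFun (D₁.ident.symm d))) sideB
  overA : IsVBMorphism A₁ A₂ sideA base
  overB : IsVBMorphism B₁ B₂ sideB base

/-- A morphism of involutive double vector bundles. -/
structure IDVBHom {Q₁ : SmoothVB (𝓡 n₁) M₁} {Q₂ : SmoothVB (𝓡 n₂) M₂}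
    (D₁ : InvolutiveDVB Q₁) (D₂ : InvolutiveDVB Q₂) extends
    DVBHom D₁.toDoubleVectorBundle D₂.toDoubleVectorBundle where
  comm_inv : ∀ d, toFun (D₁.inv d) = D₂.inv (toFun d)

/-- A smooth map `ω₀ : M₁ → M₂` with morphisms of modules over `ω₀^* : C^∞(M₂) → C^∞(M₁)`,
`ω^⋆ : 𝒞(𝔼₂) → 𝒞(𝔼₁)` and `ω_Q^⋆ : Γ(Q₂^*) → Γ(Q₁^*)`, that are compatible with the wedge product. -/
structure ModuleMorphismPair {Q₁ : SmoothVB (𝓡 n₁) M₁} {Q₂ : SmoothVB (𝓡 n₂) M₂}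
    (D₁ : InvolutiveDVB Q₁) (D₂ : InvolutiveDVB Q₂) where
  base : C^∞⟮𝓡 n₁, M₁; 𝓡 n₂, M₂⟯
  mapC : D₂.isotropicSections →ₛₗ[pullbackFun base] D₁.isotropicSections
  mapQ : Q₂.dual.Sec →ₛₗ[pullbackFun base] Q₁.dual.Sec
  map_wedge : ∀ τ₁ τ₂ : Q₂.dual.Sec,
    mapC (D₂.wedge τ₁ τ₂) = D₁.wedge (mapQ τ₁) (mapQ τ₂)

/-- The pair `T` is the one that the morphism `Ω` induces on sections of the duals: `T` and `Ω` have
the same base map `ω₀`, the map `ω^⋆` is the restriction of the dual `Ω^⋆` of `Ω : D₁ → D₂` over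
`ω_Q`, i.e. `⟨ω^⋆ χ, d⟩ = ⟨χ, Ω d⟩`, and `ω_Q^⋆` is the dual of `ω_Q : Q₁ → Q₂` over `ω₀`, i.e.
`⟨ω_Q^⋆ τ, q⟩ = ⟨τ, ω_Q q⟩`. -/
structure IDVBHom.Induces {Q₁ : SmoothVB (𝓡 n₁) M₁} {Q₂ : SmoothVB (𝓡 n₂) M₂}
    {D₁ : InvolutiveDVB Q₁} {D₂ : InvolutiveDVB Q₂} (Ω : IDVBHom D₁ D₂)
    (T : ModuleMorphismPair D₁ D₂) : Prop where
  base : ∀ m, T.base m = Ω.base m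
  mapC : ∀ (χ : D₂.isotropicSections) (d : D₁.Tot),
    linFun (T.mapC χ).1 d = linFun χ.1 (Ω.toFun d)
  mapQ : ∀ (τ : Q₂.dual.Sec) (q : Q₁.Tot), linFun (T.mapQ τ) q = linFun τ (Ω.sideA q)
end

end

/-!
A point of a vector bundle is the same as an evaluation functional on the sections of the dual, and
a map into the bundle is smooth as soon as a point-separating family of such sections pulls back to
smooth functions. So `ω_Q^⋆` is dual to a unique vector bundle morphism `ω_Q`, and it remains to see
that a point `d` of an involutive double vector bundle is the same as its two projections `a`, `b`
together with the functional `χ ↦ ⟨χ, d⟩` on `𝒞(𝔼)`, which must be `C^∞(M)`-linear and take the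
value `(τ₁ ∧ τ₂)(a, b)` on the section of `τ₁ ∧ τ₂`.

A section is linear and isotropic exactly when its function on `D` is antisymmetric under the
involution. Differentiating an arbitrary section of `𝔼 → Q` along the fibres of `π₂` and then
antisymmetrising produces enough such sections to separate the points of the core, hence points with
equal projections. Conversely a point over `(a, b)` exists because `(π₁, π₂)` is onto; subtracting
its evaluation leaves a functional that kills the wedge sections. The same differentiation, applied
to the expansion of `χ` in a cut-off frame, writes `χ` as a combination of finitely many
antisymmetrised sections and wedge sections, with coefficients of the form `⟨χ, v⟩`; so the
remaining functional is evaluation at a core element, by which the point has to be moved.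
-/

noncomputable section

open SmoothVB DoubleBundle

theorem eq_fderiv_of_homogeneous {E F : Type*} [NormedAddCommGroup E] [NormedSpace ℝ E]
    [NormedAddCommGroup F] [NormedSpace ℝ F] {k : E → F} (hk : DifferentiableAt ℝ k 0)
    (hs : ∀ (t : ℝ) (w : E), k (t • w) = t • k w) (w : E) : k w = fderiv ℝ k 0 w := by
  have h₁ : HasDerivAt (fun t : ℝ => t • w) w 0 := by
    simpa using (hasDerivAt_id (0 : ℝ)).smul_const w
  have h₂ : HasDerivAt (fun t : ℝ => k (t • w)) (fderiv ℝ k 0 w) 0 := by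
    have hk' : HasFDerivAt k (fderiv ℝ k 0) ((0 : ℝ) • w) := by
      rw [zero_smul]
      exact hk.hasFDerivAt
    exact hk'.comp_hasDerivAt 0 h₁
  have h₃ : HasDerivAt (fun t : ℝ => k (t • w)) (k w) 0 := by
    simpa [hs] using (hasDerivAt_id (0 : ℝ)).smul_const (k w)
  exact h₃.unique h₂

namespace SmoothVB

open Topology

variable {E H : Type*} [NormedAddCommGroup E] [NormedSpace ℝ E] [TopologicalSpace H]
  {I : ModelWithCorners ℝ E H} {M : Type u} [TopologicalSpace M] [ChartedSpace H M]

section Algebra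

variable {V : SmoothVB I M}

theorem tsmul_proj (t : ℝ) (x : V.Tot) : (tsmul t x).proj = x.proj := rfl

theorem one_tsmul (x : V.Tot) : tsmul 1 x = x := by
  rw [tsmul, one_smul]

theorem tsmul_tsmul (s t : ℝ) (x : V.Tot) : tsmul s (tsmul t x) = tsmul (s * t) x :=
  congrArg (fun u => (⟨x.proj, u⟩ : V.Tot)) (smul_smul s t x.2)

theorem tadd_comm {x y : V.Tot} (h : x.proj = y.proj) : tadd x y = tadd y x := by
  obtain ⟨m, x⟩ := x
  obtain ⟨m', y⟩ := y
  obtain rfl : m = m' := h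
  rw [tadd_mk, tadd_mk, add_comm]

theorem tzero_tadd (x : V.Tot) : tadd (tzero V x.proj) x = x :=
  (tadd_comm (x := tzero V x.proj) (y := x) rfl).trans (tadd_tzero x)

theorem tadd_tsmul (s t : ℝ) (x : V.Tot) : tadd (tsmul s x) (tsmul t x) = tsmul (s + t) x := by
  obtain ⟨m, x⟩ := x
  simp only [tsmul_mk, tadd_mk, add_smul]

theorem tadd_tsmul_neg_one (x : V.Tot) : tadd x (tsmul (-1) x) = tzero V x.proj := by
  obtain ⟨m, x⟩ := x
  simp [tsmul_mk, tzero]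

theorem tadd_tadd_tsmul_neg_one {x y : V.Tot} (h : x.proj = y.proj) :
    tadd y (tadd x (tsmul (-1) y)) = x := by
  obtain ⟨m, x⟩ := x
  obtain ⟨m', y⟩ := y
  obtain rfl : m = m' := h
  simp [tsmul_mk]

theorem dual_ext {s s' : V.dual.Sec} (h : ∀ x, linFun s x = linFun s' x) : s = s' :=
  ContMDiffSection.ext fun m => ContinuousLinearMap.ext fun x => h ⟨m, x⟩

/-- Evaluation at the point `x`, as a functional on the sections of the dual. -/
def evalHom (x : V.Tot) : V.dual.Sec →+ ℝ where
  toFun s := linFun s x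
  map_zero' := rfl
  map_add' _ _ := rfl

theorem linFun_sum {ι : Type*} (S : Finset ι) (s : ι → V.dual.Sec) (x : V.Tot) :
    linFun (∑ i ∈ S, s i) x = ∑ i ∈ S, linFun (s i) x :=
  map_sum (evalHom x) s S

theorem linFun_sum_smul (τ : V.dual.Sec) {m : M} {ι : Type*} [Fintype ι] (c : ι → ℝ)
    (v : ι → V.Fib m) : linFun τ ⟨m, ∑ i, c i • v i⟩ = ∑ i, c i * linFun τ ⟨m, v i⟩ :=
  (map_sum (τ m) _ _).trans (Finset.sum_congr rfl fun i _ => (τ m).map_smul (c i) (v i))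

end Algebra

section Smoothness

theorem contMDiff_tzero (V : SmoothVB I M) : ContMDiff I (I.prod 𝓘(ℝ, V.F)) ∞ (tzero V) :=
  contMDiff_zeroSection ℝ V.Fib

theorem contMDiff_pt {V : SmoothVB I M} (s : V.Sec) : ContMDiff I (I.prod 𝓘(ℝ, V.F)) ∞ (pt s) :=
  s.contMDiff

theorem contMDiff_tsmul (V : SmoothVB I M) :
    ContMDiff (𝓘(ℝ, ℝ).prod (I.prod 𝓘(ℝ, V.F))) (I.prod 𝓘(ℝ, V.F)) ∞
      (fun p : ℝ × V.Tot => tsmul p.1 p.2) := by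
  intro p₀
  let e := trivializationAt V.F V.Fib p₀.2.proj
  have hproj : ContMDiff (𝓘(ℝ, ℝ).prod (I.prod 𝓘(ℝ, V.F))) I ∞ (fun p : ℝ × V.Tot => p.2.proj) :=
    (contMDiff_proj V.Fib).comp contMDiff_snd
  have hfibre : ContMDiffAt (𝓘(ℝ, ℝ).prod (I.prod 𝓘(ℝ, V.F))) 𝓘(ℝ, V.F) ∞
      (fun p : ℝ × V.Tot => p.1 • (e p.2).2) p₀ :=
    contMDiffAt_fst.smul
      ((contMDiffAt_totalSpace.1 (contMDiffAt_id (x := p₀.2) (n := ∞))).2.comp p₀ contMDiffAt_snd)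
  refine contMDiffAt_totalSpace.2 ⟨hproj.contMDiffAt, hfibre.congr_of_eventuallyEq ?_⟩
  filter_upwards [hproj.continuous.continuousAt.preimage_mem_nhds
    (e.open_baseSet.mem_nhds (FiberBundle.mem_baseSet_trivializationAt' p₀.2.proj))] with p hp
  exact (e.linear ℝ hp).map_smul p.1 p.2.2

/-- The identification of the model fibre with the fibre over `m`. -/
def fibreEquiv (V : SmoothVB I M) (m : M) : V.F ≃L[ℝ] V.Fib m :=
  (VectorBundle.continuousLinearEquivAt ℝ V.F V.Fib m).symm

theorem finiteDimensional_fib (V : SmoothVB I M) (m : M) : FiniteDimensional ℝ (V.Fib m) :=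
  (V.fibreEquiv m).toLinearEquiv.finiteDimensional

theorem contMDiff_mk_fibreEquiv (V : SmoothVB I M) (m : M) :
    ContMDiff 𝓘(ℝ, V.F) (I.prod 𝓘(ℝ, V.F)) ∞ (fun v => (⟨m, V.fibreEquiv m v⟩ : V.Tot)) := by
  intro v
  let e := trivializationAt V.F V.Fib m
  have hm : m ∈ e.baseSet := FiberBundle.mem_baseSet_trivializationAt' m
  have h := (e.contMDiffOn_symm (IB := I) (n := ∞)).contMDiffAt (x := (m, v))
    (e.open_target.mem_nhds (e.mem_target.2 hm))
  refine (h.comp v (contMDiffAt_const.prodMk contMDiffAt_id)).congr_of_eventuallyEq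
    (.of_forall fun w => ?_)
  exact (e.symm_apply_eq_mk_continuousLinearEquivAt_symm m hm w).symm

variable {V : SmoothVB I M} {g : V.Tot → ℝ} (hg : ContMDiff (I.prod 𝓘(ℝ, V.F)) 𝓘(ℝ, ℝ) ∞ g)

include hg

theorem add_of_homogeneous (hs : ∀ (t : ℝ) (x : V.Tot), g (tsmul t x) = t * g x) (m : M)
    (u v : V.Fib m) : g ⟨m, u + v⟩ = g ⟨m, u⟩ + g ⟨m, v⟩ := by
  let k : V.F → ℝ := fun w => g ⟨m, V.fibreEquiv m w⟩
  have hk : DifferentiableAt ℝ k 0 :=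
    (hg.comp (V.contMDiff_mk_fibreEquiv m)).contDiff.differentiable (by simp) 0
  have hlin : ∀ w, g ⟨m, w⟩ = fderiv ℝ k 0 ((V.fibreEquiv m).symm w) := fun w => by
    rw [← eq_fderiv_of_homogeneous hk fun t w => ?_]
    · simp only [k, ContinuousLinearEquiv.apply_symm_apply]
    · simp only [k, map_smul]
      exact hs t ⟨m, V.fibreEquiv m w⟩
  simp only [hlin, map_add]

/-- The section of the dual bundle defined by a smooth function that is homogeneous of degree one on
the fibres. Such a function equals its derivative at zero on every fibre, so it is additive. -/
def secOfHomogeneous (hs : ∀ (t : ℝ) (x : V.Tot), g (tsmul t x) = t * g x) : V.dual.Sec :=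
  secOfFun g hg (add_of_homogeneous hg hs) fun m t u => hs t ⟨m, u⟩

@[simp] theorem linFun_secOfHomogeneous (hs : ∀ (t : ℝ) (x : V.Tot), g (tsmul t x) = t * g x)
    (x : V.Tot) : linFun (secOfHomogeneous hg hs) x = g x := rfl

theorem hasDerivAt_comp_tsmul (x : V.Tot) :
    HasDerivAt (fun t : ℝ => g (tsmul t x)) (deriv (fun t : ℝ => g (tsmul t x)) 0) 0 :=
  (((hg.comp V.contMDiff_tsmul).comp
    (contMDiff_id.prodMk (contMDiff_const (c := x)))).contDiff.differentiable (by simp)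
      0).hasDerivAt

theorem deriv_comp_tsmul_tsmul (s : ℝ) (x : V.Tot) :
    deriv (fun t : ℝ => g (tsmul t (tsmul s x))) 0 = s * deriv (fun t : ℝ => g (tsmul t x)) 0 := by
  have hmul : HasDerivAt (fun t : ℝ => t * s) s 0 := by
    simpa using (hasDerivAt_id (0 : ℝ)).mul_const s
  have hg' := hasDerivAt_comp_tsmul hg x
  rw [← zero_mul s] at hg'
  simp only [tsmul_tsmul]
  simpa [Function.comp_def, mul_comm] using (hg'.comp 0 hmul).deriv

theorem contMDiff_deriv_comp_tsmul [IsManifold I ∞ M] :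
    ContMDiff (I.prod 𝓘(ℝ, V.F)) 𝓘(ℝ, ℝ) ∞
      (fun x : V.Tot => deriv (fun t : ℝ => g (tsmul t x)) 0) := by
  intro x₀
  have h := ContMDiffAt.mfderiv (I := 𝓘(ℝ, ℝ)) (I' := 𝓘(ℝ, ℝ)) (J := I.prod 𝓘(ℝ, V.F))
    (n := ∞) (m := ∞) (x₀ := x₀) (fun (x : V.Tot) (t : ℝ) => g (tsmul t x)) (fun _ => (0 : ℝ))
    (((hg.comp V.contMDiff_tsmul).comp (contMDiff_snd.prodMk contMDiff_fst)).contMDiffAt)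
    contMDiffAt_const (by simp)
  have hfderiv : ContMDiffAt (I.prod 𝓘(ℝ, V.F)) 𝓘(ℝ, ℝ →L[ℝ] ℝ) ∞
      (fun x : V.Tot => (fderiv ℝ (fun t : ℝ => g (tsmul t x)) 0 : ℝ →L[ℝ] ℝ)) x₀ := by
    refine h.congr_of_eventuallyEq (.of_forall fun x => mfderiv_eq_fderiv.symm.trans ?_)
    exact (congrFun (inTangentCoordinates_model_space (I := 𝓘(ℝ, ℝ)) (I' := 𝓘(ℝ, ℝ))
      (fun _ : V.Tot => (0 : ℝ)) (fun x => g (tsmul 0 x))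
      (fun x => mfderiv 𝓘(ℝ, ℝ) 𝓘(ℝ, ℝ) (fun t : ℝ => g (tsmul t x)) 0) x₀) x).symm
  exact hfderiv.clm_apply (contMDiffAt_const (c := (1 : ℝ)))

/-- The derivative along the fibres at the zero section, as a section of the dual bundle. -/
def fibreDeriv [IsManifold I ∞ M] : V.dual.Sec :=
  secOfHomogeneous (contMDiff_deriv_comp_tsmul hg) (deriv_comp_tsmul_tsmul hg)

theorem hasDerivAt_fibreDeriv [IsManifold I ∞ M] (x : V.Tot) :
    HasDerivAt (fun t : ℝ => g (tsmul t x)) (linFun (fibreDeriv hg) x) 0 :=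
  hasDerivAt_comp_tsmul hg x

end Smoothness

section Hausdorff

variable [T2Space M]

instance (V : SmoothVB I M) : T2Space V.Tot := by
  refine ⟨fun x y hxy => ?_⟩
  by_cases h : x.proj = y.proj
  · let e := trivializationAt V.F V.Fib x.proj
    have hx : x ∈ e.source := FiberBundle.mem_trivializationAt_proj_source
    have hy : y ∈ e.source := e.mem_source.2 (h ▸ FiberBundle.mem_baseSet_trivializationAt' _)
    obtain ⟨u, v, hu, hv, hxu, hyv, huv⟩ := t2_separation (e.injOn.ne hx hy hxy)
    exact ⟨_, _, e.toOpenPartialHomeomorph.isOpen_inter_preimage hu,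
      e.toOpenPartialHomeomorph.isOpen_inter_preimage hv, ⟨hx, hxu⟩, ⟨hy, hyv⟩,
      (huv.preimage e).mono Set.inter_subset_right Set.inter_subset_right⟩
  · exact separated_by_continuous (FiberBundle.continuous_proj V.F V.Fib) h

variable [FiniteDimensional ℝ E] [IsManifold I ∞ M]

theorem exists_cutoff (x₀ : M) {U : Set M} (hU : U ∈ 𝓝 x₀) :
    ∃ ρ : C^∞⟮I, M; ℝ⟯, ρ x₀ = 1 ∧ tsupport ρ ⊆ U := by
  obtain ⟨f, -, hf⟩ := ((SmoothBumpFunction.nhds_basis_tsupport (I := I) x₀).mem_iff).1 hU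
  exact ⟨⟨f, f.contMDiff⟩, f.eq_one, hf⟩

end Hausdorff

section Frames

variable {V : SmoothVB I M} {x₀ : M} {ρ : C^∞⟮I, M; ℝ⟯}
  (hρ : tsupport ρ ⊆ (trivializationAt V.F V.Fib x₀).baseSet)

include hρ

theorem contMDiff_cutoff_trivialization (φ : V.F →L[ℝ] ℝ) :
    ContMDiff (I.prod 𝓘(ℝ, V.F)) 𝓘(ℝ, ℝ) ∞
      (fun x : V.Tot => ρ x.proj * φ (trivializationAt V.F V.Fib x₀ x).2) := by
  intro x
  let e := trivializationAt V.F V.Fib x₀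
  by_cases hx : x.proj ∈ tsupport ρ
  · have he : ContMDiffAt (I.prod 𝓘(ℝ, V.F)) 𝓘(ℝ, V.F) ∞ (fun y : V.Tot => (e y).2) x :=
      ((e.contMDiffOn (IB := I) (n := ∞)).contMDiffAt
        (e.open_source.mem_nhds (e.mem_source.2 (hρ hx)))).snd
    exact (ρ.contMDiff.comp (contMDiff_proj V.Fib)).contMDiffAt.mul
      (φ.contDiff.contMDiff.contMDiffAt.comp x he)
  · refine (contMDiffAt_const (c := (0 : ℝ))).congr_of_eventuallyEq ?_
    filter_upwards [(FiberBundle.continuous_proj V.F V.Fib).continuousAt.preimage_mem_nhds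
      ((isClosed_tsupport ρ).isOpen_compl.mem_nhds hx)] with y hy
    rw [image_eq_zero_of_notMem_tsupport hy, zero_mul]

/-- The section of the dual that is the form `φ` in the trivialization at `x₀`, cut off by `ρ`. -/
def cutoffForm (φ : V.F →L[ℝ] ℝ) : V.dual.Sec :=
  secOfHomogeneous (contMDiff_cutoff_trivialization hρ φ) fun t x => by
    by_cases hx : x.proj ∈ tsupport ρ
    · have h : (trivializationAt V.F V.Fib x₀ (tsmul t x)).2 =
          t • (trivializationAt V.F V.Fib x₀ x).2 :=
        ((trivializationAt V.F V.Fib x₀).linear ℝ (hρ hx)).map_smul t x.2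
      rw [h, tsmul_proj, map_smul, smul_eq_mul, mul_left_comm]
    · simp only [tsmul_proj, image_eq_zero_of_notMem_tsupport hx, zero_mul, mul_zero]

/-- The section that is the vector `v` in the trivialization at `x₀`, cut off by `ρ`. -/
def cutoffVector (v : V.F) : V.Sec where
  toFun m := ρ m • (trivializationAt V.F V.Fib x₀).symm m v
  contMDiff_toFun := by
    refine ContMDiffOn.smul_section_of_tsupport ρ.contMDiff.contMDiffOn
      (trivializationAt V.F V.Fib x₀).open_baseSet hρ ?_
    rw [Trivialization.contMDiffOn_section_baseSet_iff]
    exact (contMDiffOn_const (c := v)).congr fun m hm => by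
      rw [Trivialization.apply_mk_symm _ hm]

theorem sum_cutoffForm_smul_cutoffVector {ι : Type*} [Fintype ι] (b : Module.Basis ι ℝ V.F) (m : M)
    (x : V.Fib m) :
    ∑ i, linFun (cutoffForm hρ (b.coord i).toContinuousLinearMap) ⟨m, x⟩ • cutoffVector hρ (b i) m =
      (ρ m * ρ m) • x := by
  let e := trivializationAt V.F V.Fib x₀
  change ∑ i, (ρ m * b.repr (e ⟨m, x⟩).2 i) • ρ m • e.symm m (b i) = _
  by_cases hm : m ∈ e.baseSet
  · have hx : ∑ i, b.repr (e ⟨m, x⟩).2 i • e.symm m (b i) = x := by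
      simp only [← Trivialization.symmL_apply (R := ℝ) e hm, ← map_smul, ← map_sum, b.sum_repr]
      rw [Trivialization.symmL_apply e hm, e.symm_apply_apply_mk hm]
    conv_rhs => rw [← hx, Finset.smul_sum]
    refine Finset.sum_congr rfl fun i _ => ?_
    rw [smul_smul, smul_smul, mul_right_comm]
  · simp [image_eq_zero_of_notMem_tsupport fun h => hm (hρ h)]

end Frames

section Sections

variable [T2Space M] [FiniteDimensional ℝ E] [IsManifold I ∞ M]

theorem exists_cutoff_frame (V : SmoothVB I M) (x₀ : M) :
    ∃ (k : ℕ) (ρ : C^∞⟮I, M; ℝ⟯) (g : Fin k → V.dual.Sec) (s : Fin k → V.Sec), ρ x₀ = 1 ∧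
      ∀ (m : M) (x : V.Fib m), ∑ i, linFun (g i) ⟨m, x⟩ • s i m = (ρ m * ρ m) • x := by
  obtain ⟨ρ, hρ₀, hρ⟩ := exists_cutoff (I := I) x₀ ((trivializationAt V.F V.Fib
    x₀).open_baseSet.mem_nhds (FiberBundle.mem_baseSet_trivializationAt' x₀))
  exact ⟨_, ρ, _, _, hρ₀, sum_cutoffForm_smul_cutoffVector hρ (Module.finBasis ℝ V.F)⟩

variable {V : SmoothVB I M}

theorem eq_of_linFun_eq {x y : V.Tot} (h : x.proj = y.proj)
    (hxy : ∀ τ : V.dual.Sec, linFun τ x = linFun τ y) : x = y := by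
  obtain ⟨m, x⟩ := x
  obtain ⟨m', y⟩ := y
  obtain rfl : m = m' := h
  obtain ⟨k, ρ, g, s, hρ, hg⟩ := V.exists_cutoff_frame m
  have h : (ρ m * ρ m) • x = (ρ m * ρ m) • y := by simp only [← hg, hxy]
  simpa only [hρ, mul_one, one_smul] using congrArg (TotalSpace.mk m) h

theorem exists_sec_through (x : V.Tot) : ∃ s : V.Sec, pt s x.proj = x := by
  obtain ⟨k, ρ, g, s, hρ, hg⟩ := V.exists_cutoff_frame x.proj
  refine ⟨∑ i, linFun (g i) x • s i, congrArg (fun z => (⟨x.proj, z⟩ : V.Tot)) ?_⟩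
  calc (∑ i, linFun (g i) x • s i) x.proj = ∑ i, linFun (g i) x • s i x.proj := by
        rw [← ContMDiffSection.coeAddHom_apply, map_sum, Finset.sum_apply]; rfl
    _ = x.2 := by rw [hg, hρ, mul_one, one_smul]

/-- The function `m ↦ ⟨τ m, s m⟩` on the base. -/
def pairing (τ : V.dual.Sec) (s : V.Sec) : C^∞⟮I, M; ℝ⟯ :=
  ⟨fun m => linFun τ (pt s m), (linFun_contMDiff τ).comp (contMDiff_pt s)⟩

theorem exists_dual_generators (V : SmoothVB I M) (x₀ : M) :
    ∃ (k : ℕ) (ρ : C^∞⟮I, M; ℝ⟯) (g : Fin k → V.dual.Sec) (s : Fin k → V.Sec), ρ x₀ = 1 ∧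
      ∀ τ : V.dual.Sec, (ρ * ρ) • τ = ∑ i, pairing τ (s i) • g i := by
  obtain ⟨k, ρ, g, s, hρ, hg⟩ := V.exists_cutoff_frame x₀
  refine ⟨k, ρ, g, s, hρ, fun τ => dual_ext fun ⟨m, x⟩ => ?_⟩
  have h : τ m ((ρ m * ρ m) • x) = ∑ i, τ m (linFun (g i) ⟨m, x⟩ • s i m) := by
    rw [← hg m x, map_sum]
  rw [linFun_sum]
  refine ((τ m).map_smul _ x).symm.trans (h.trans (Finset.sum_congr rfl fun i _ => ?_))
  exact ((τ m).map_smul _ _).trans (mul_comm _ _)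

theorem exists_eq_linFun (m : M) (Λ : V.dual.Sec →+ ℝ)
    (hΛ : ∀ (f : C^∞⟮I, M; ℝ⟯) τ, Λ (f • τ) = f m * Λ τ) :
    ∃ x : V.Tot, x.proj = m ∧ ∀ τ, linFun τ x = Λ τ := by
  obtain ⟨k, ρ, g, s, hρ, hg⟩ := V.exists_dual_generators m
  refine ⟨⟨m, ∑ i, Λ (g i) • s i m⟩, rfl, fun τ => ?_⟩
  calc linFun τ ⟨m, ∑ i, Λ (g i) • s i m⟩ = ∑ i, Λ (g i) * pairing τ (s i) m :=
        linFun_sum_smul τ _ _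
    _ = Λ (∑ i, pairing τ (s i) • g i) := by simp only [map_sum, hΛ, mul_comm]
    _ = Λ τ := by
        rw [← hg, hΛ, ContMDiffMap.coe_mul, Pi.mul_apply, hρ, one_mul, one_mul]

end Sections

section SmoothnessCriterion

variable {V : SmoothVB I M}
  {E' H' : Type*} [NormedAddCommGroup E'] [NormedSpace ℝ E'] [TopologicalSpace H']
  {J : ModelWithCorners ℝ E' H'} {X : Type v} [TopologicalSpace X] [ChartedSpace H' X]

theorem trivializationAt_dual_apply {x₀ m : M} (hm : m ∈ (trivializationAt V.F V.Fib x₀).baseSet)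
    (s : V.dual.Sec) (x : V.Fib m) :
    (trivializationAt V.dual.F V.dual.Fib x₀ (pt s m)).2 (trivializationAt V.F V.Fib x₀ ⟨m, x⟩).2 =
      linFun s ⟨m, x⟩ := by
  rw [pt, hom_trivializationAt_apply]
  simp [ContinuousLinearMap.inCoordinates, linFun, Trivial.continuousLinearMapAt_trivialization,
    Trivialization.symmL_apply _ hm, Trivialization.symm_apply_apply_mk _ hm]

theorem contMDiffAt_of_coframe {ι : Type*} [Finite ι] (b : Module.Basis ι ℝ V.F)
    (s : ι → V.dual.Sec) {Ψ : X → V.Tot} {y₀ : X}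
    (hproj : ContMDiffAt J I ∞ (fun y => (Ψ y).proj) y₀)
    (hΨ : ∀ i, ContMDiffAt J 𝓘(ℝ, ℝ) ∞ (fun y => linFun (s i) (Ψ y)) y₀)
    (hs : ∀ i v, linFun (s i) ⟨(Ψ y₀).proj, V.fibreEquiv _ v⟩ = b.coord i v) :
    ContMDiffAt J (I.prod 𝓘(ℝ, V.F)) ∞ Ψ y₀ := by
  cases nonempty_fintype ι
  set x₀ := (Ψ y₀).proj
  let e := trivializationAt V.F V.Fib x₀
  have hmem : x₀ ∈ e.baseSet := FiberBundle.mem_baseSet_trivializationAt' x₀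
  -- `G m` sends the coordinates of a vector to its values on the sections `s i`.
  let G : M → V.F →L[ℝ] V.F := fun m =>
    ∑ i, (trivializationAt V.dual.F V.dual.Fib x₀ (pt (s i) m)).2.smulRight (b i)
  have hGe : ∀ m ∈ e.baseSet, ∀ x : V.Fib m,
      G m (e ⟨m, x⟩).2 = ∑ i, linFun (s i) ⟨m, x⟩ • b i := fun m hm x => by
    simp only [G, sum_apply, ContinuousLinearMap.smulRight_apply, e,
      trivializationAt_dual_apply hm]
  have hG : ContMDiffAt I 𝓘(ℝ, V.F →L[ℝ] V.F) ∞ G x₀ := ContMDiffAt.sum fun i _ =>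
    ((ContinuousLinearMap.smulRightL ℝ V.F V.F).flip (b i)).contDiff.contMDiff.contMDiffAt.comp x₀
      (contMDiffAt_totalSpace.1 ((s i).contMDiff x₀)).2
  have hG₀ : G x₀ = 1 := by
    ext v
    have hv : (e ⟨x₀, V.fibreEquiv x₀ v⟩).2 = v :=
      (VectorBundle.continuousLinearEquivAt ℝ V.F V.Fib x₀).apply_symm_apply v
    have h := hGe x₀ hmem (V.fibreEquiv x₀ v)
    simp only [hv, hs, Module.Basis.coord_apply, b.sum_repr] at h
    exact h
  have hinv : ContMDiffAt J 𝓘(ℝ, V.F →L[ℝ] V.F) ∞ (fun y => Ring.inverse (G (Ψ y).proj)) y₀ := by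
    have h : ContDiffAt ℝ ∞ Ring.inverse (G x₀) := hG₀ ▸ contDiffAt_ringInverse ℝ 1
    exact h.contMDiffAt.comp y₀ (hG.comp y₀ hproj)
  have hunit : ∀ᶠ m in 𝓝 x₀, IsUnit (G m) :=
    hG.continuousAt.eventually (Units.isOpen.mem_nhds (hG₀ ▸ isUnit_one))
  have hsum : ContMDiffAt J 𝓘(ℝ, V.F) ∞ (fun y => ∑ i, linFun (s i) (Ψ y) • b i) y₀ :=
    ContMDiffAt.sum fun i _ => (hΨ i).smul contMDiffAt_const
  refine contMDiffAt_totalSpace.2 ⟨hproj, (hinv.clm_apply hsum).congr_of_eventuallyEq ?_⟩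
  filter_upwards [hproj.continuousAt.eventually hunit,
    hproj.continuousAt.preimage_mem_nhds (e.open_baseSet.mem_nhds hmem)] with y hy hy'
  rw [← hGe _ hy' (Ψ y).2, ← mul_apply_eq_comp, Ring.inverse_mul_cancel _ hy]
  rfl

theorem exists_apply_eq_of_separating (S : Submodule ℝ V.dual.Sec) (m : M)
    (hsep : ∀ x : V.Fib m, (∀ s ∈ S, linFun s ⟨m, x⟩ = 0) → x = 0) (φ : Module.Dual ℝ (V.Fib m)) :
    ∃ s ∈ S, ∀ x, linFun s ⟨m, x⟩ = φ x := by
  have := V.finiteDimensional_fib m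
  let evalAt : V.dual.Sec →ₗ[ℝ] Module.Dual ℝ (V.Fib m) :=
    { toFun s := (s m).toLinearMap
      map_add' _ _ := rfl
      map_smul' _ _ := rfl }
  have : FiniteDimensional ℝ (S.map evalAt) := FiniteDimensional.finiteDimensional_submodule _
  have htop : S.map evalAt = ⊤ := by
    have hbot : (S.map evalAt).dualCoannihilator = ⊥ := by
      refine (Submodule.eq_bot_iff _).2 fun x hx => hsep x fun s hs => ?_
      exact (Submodule.mem_dualCoannihilator _).1 hx _ (Submodule.mem_map_of_mem hs)
    rw [← Subspace.dualCoannihilator_dualAnnihilator_eq (W := S.map evalAt), hbot,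
      Submodule.dualAnnihilator_bot]
  obtain ⟨s, hs, hφ⟩ : φ ∈ S.map evalAt := htop ▸ Submodule.mem_top
  exact ⟨s, hs, LinearMap.congr_fun hφ⟩

/-- The sections of the dual of `V` whose linear functions have a smooth composition with `Ψ`. -/
def smoothAlong (V : SmoothVB I M) (J : ModelWithCorners ℝ E' H') (Ψ : X → V.Tot) :
    Submodule ℝ V.dual.Sec where
  carrier := {s | ContMDiff J 𝓘(ℝ, ℝ) ∞ (fun y => linFun s (Ψ y))}
  add_mem' hs ht := hs.add ht
  zero_mem' := contMDiff_const
  smul_mem' _ _ hs := contMDiff_const.mul hs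

theorem contMDiff_of_linFun {Ψ : X → V.Tot} (hproj : ContMDiff J I ∞ (fun y => (Ψ y).proj))
    (hsep : ∀ (m : M) (x : V.Fib m), (∀ s : V.dual.Sec,
      ContMDiff J 𝓘(ℝ, ℝ) ∞ (fun y => linFun s (Ψ y)) → linFun s ⟨m, x⟩ = 0) → x = 0) :
    ContMDiff J (I.prod 𝓘(ℝ, V.F)) ∞ Ψ := fun y₀ => by
  let b := Module.finBasis ℝ V.F
  have hcoord := fun i => exists_apply_eq_of_separating (V.smoothAlong J Ψ) (Ψ y₀).proj (hsep _)
    ((b.coord i).comp (V.fibreEquiv _).symm.toLinearMap)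
  choose s hs hb using hcoord
  exact contMDiffAt_of_coframe b s (hproj y₀) (fun i => hs i y₀) fun i v => by simp [hb]

end SmoothnessCriterion

end SmoothVB

namespace IsVBMorphism

variable {E : Type*} [NormedAddCommGroup E] [NormedSpace ℝ E] {H : Type*} [TopologicalSpace H]
  {I : ModelWithCorners ℝ E H} {M : Type u} [TopologicalSpace M] [ChartedSpace H M]
  {E' : Type*} [NormedAddCommGroup E'] [NormedSpace ℝ E'] {H' : Type*} [TopologicalSpace H']
  {J : ModelWithCorners ℝ E' H'} {N : Type v} [TopologicalSpace N] [ChartedSpace H' N]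
  {V : SmoothVB I M} {W : SmoothVB J N} {Ψ : V.Tot → W.Tot} {f : M → N}

/-- The pullback of a section of the dual along a morphism of vector bundles. -/
def pullback (hΨ : IsVBMorphism V W Ψ f) (τ : W.dual.Sec) : V.dual.Sec :=
  secOfHomogeneous ((linFun_contMDiff τ).comp hΨ.smooth) fun t x =>
    (congrArg (linFun τ) (hΨ.map_smul t x)).trans (linFun_tsmul τ t _)

theorem comp {E'' : Type*} [NormedAddCommGroup E''] [NormedSpace ℝ E'']
    {H'' : Type*} [TopologicalSpace H''] {K : ModelWithCorners ℝ E'' H''} {P : Type*}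
    [TopologicalSpace P] [ChartedSpace H'' P] {U : SmoothVB K P} {Φ : W.Tot → U.Tot} {g : N → P}
    (hΦ : IsVBMorphism W U Φ g) (hΨ : IsVBMorphism V W Ψ f) :
    IsVBMorphism V U (Φ ∘ Ψ) (g ∘ f) where
  smooth := hΦ.smooth.comp hΨ.smooth
  smooth_base := hΦ.smooth_base.comp hΨ.smooth_base
  proj x := (hΦ.proj _).trans (congrArg g (hΨ.proj x))
  map_add x y h := (congrArg Φ (hΨ.map_add x y h)).trans
    (hΦ.map_add _ _ (by rw [hΨ.proj, hΨ.proj, h]))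
  map_smul t x := (congrArg Φ (hΨ.map_smul t x)).trans (hΦ.map_smul t _)

theorem of_separating [IsManifold J ∞ N] [T2Space N] (S : Set W.dual.Sec)
    (hS : ∀ x y : W.Tot, x.proj = y.proj → (∀ τ ∈ S, linFun τ x = linFun τ y) → x = y)
    (hf : ContMDiff I J ∞ f) (hproj : ∀ x, (Ψ x).proj = f x.proj)
    (hΨ : ∀ τ ∈ S, ∃ σ : V.dual.Sec, ∀ x, linFun τ (Ψ x) = linFun σ x) :
    IsVBMorphism V W Ψ f where
  smooth := by
    refine contMDiff_of_linFun ?_ fun m x hx => ?_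
    · simp only [hproj]
      exact hf.comp (contMDiff_proj V.Fib)
    · refine TotalSpace.mk_inj.1 (hS ⟨m, x⟩ (tzero W m) rfl fun τ hτ => ?_)
      obtain ⟨σ, hσ⟩ := hΨ τ hτ
      rw [linFun_tzero]
      exact hx τ (by simpa only [hσ] using linFun_contMDiff σ)
  smooth_base := hf
  proj := hproj
  map_add x y h := by
    have hxy : (Ψ x).proj = (Ψ y).proj := by rw [hproj, hproj, h]
    refine hS _ _ (by rw [hproj, tadd_proj, tadd_proj, hproj]) fun τ hτ => ?_
    obtain ⟨σ, hσ⟩ := hΨ τ hτ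
    rw [hσ, linFun_tadd σ x y h, linFun_tadd τ _ _ hxy, hσ, hσ]
  map_smul t x := by
    refine hS _ _ (by rw [hproj, tsmul_proj, tsmul_proj, hproj]) fun τ hτ => ?_
    obtain ⟨σ, hσ⟩ := hΨ τ hτ
    rw [hσ, linFun_tsmul, linFun_tsmul, hσ]

end IsVBMorphism

namespace DoubleVectorBundle

variable {n : ℕ} {M : Type u} [TopologicalSpace M] [ChartedSpace (EuclideanSpace ℝ (Fin n)) M]
  {A B : SmoothVB (𝓡 n) M} (D : DoubleVectorBundle A B)

section Algebra

/-- The zero section of `D → B`. -/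
def zero₂ (b : B.Tot) : D.Tot := D.ident.symm (tzero D.over₂ b)

variable {D} in
theorem ident_inj {d d' : D.Tot} (h : D.ident d = D.ident d') : d = d' := D.ident.injective h

variable {D} in
theorem ident_smul₂ (t : ℝ) (d : D.Tot) : D.ident (smul₂ t d) = tsmul t (D.ident d) :=
  D.ident.apply_symm_apply _

variable {D} in
theorem ident_add₂ (d d' : D.Tot) : D.ident (add₂ d d') = tadd (D.ident d) (D.ident d') :=
  D.ident.apply_symm_apply _

theorem ident_zero₂ (b : B.Tot) : D.ident (D.zero₂ b) = tzero D.over₂ b :=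
  D.ident.apply_symm_apply _

theorem π₂_zero₂ (b : B.Tot) : π₂ (D.zero₂ b) = b :=
  congrArg TotalSpace.proj (D.ident_zero₂ b)

theorem smul₂_zero (d : D.Tot) : smul₂ 0 d = D.zero₂ (π₂ d) :=
  congrArg D.ident.symm (zero_tsmul (D.ident d))

theorem one_smul₂ (d : D.Tot) : smul₂ 1 d = d :=
  ident_inj ((ident_smul₂ 1 d).trans (one_tsmul _))

theorem add_smul₂ (s t : ℝ) (d : D.Tot) : smul₂ (s + t) d = add₂ (smul₂ s d) (smul₂ t d) :=
  ident_inj <| by simp only [ident_add₂, ident_smul₂, tadd_tsmul]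

theorem smul₁_zero (d : D.Tot) : smul₁ 0 d = D.zero₁ (π₁ d) :=
  zero_tsmul (V := D.over₁) d

theorem π₁_zero₁ (a : A.Tot) : π₁ (D.zero₁ a) = a := rfl

theorem π₁_add₁ (d d' : D.Tot) : π₁ (add₁ d d') = π₁ d := tadd_proj d d'

theorem π₁_smul₁ (t : ℝ) (d : D.Tot) : π₁ (smul₁ t d) = π₁ d := rfl

theorem π₂_smul₁ (t : ℝ) (d : D.Tot) : π₂ (smul₁ t d) = tsmul t (π₂ d) := D.proj₂.map_smul t d

theorem π₁_zero₂ (b : B.Tot) : π₁ (D.zero₂ b) = tzero A b.proj := by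
  have h := D.π₁_smul₂ 0 (D.zero₂ b)
  rwa [smul₂_zero, π₂_zero₂, zero_tsmul, D.square, π₂_zero₂] at h

theorem zero₁_tzero (m : M) : D.zero₁ (tzero A m) = D.zero₂ (tzero B m) := by
  have h := D.smul₂_smul₁ 0 0 (D.zero₁ (tzero A m))
  rw [smul₂_zero, π₂_smul₁, π₂_zero₁, smul₁_zero, π₁_smul₂, π₁_zero₁, tsmul_tzero,
    tsmul_tzero] at h
  exact h.symm

theorem zero₂_tsmul (t : ℝ) (b : B.Tot) : D.zero₂ (tsmul t b) = smul₁ t (D.zero₂ b) := by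
  have h := D.smul₂_smul₁ 0 t (D.zero₂ b)
  rwa [smul₂_zero, smul₂_zero, π₂_smul₁, π₂_zero₂] at h

variable {D} in
theorem add₁_zero₁ {d : D.Tot} {a : A.Tot} (h : π₁ d = a) : add₁ d (D.zero₁ a) = d := by
  subst h
  exact tadd_tzero d

variable {D} in
theorem zero₁_add₁ {d : D.Tot} {a : A.Tot} (h : π₁ d = a) : add₁ (D.zero₁ a) d = d := by
  subst h
  exact tzero_tadd (V := D.over₁) d

variable {D} in
theorem add₂_zero₂ {d : D.Tot} {b : B.Tot} (h : π₂ d = b) : add₂ d (D.zero₂ b) = d := by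
  subst h
  apply ident_inj
  rw [ident_add₂, ident_zero₂]
  exact tadd_tzero (D.ident d)

variable {D} in
theorem zero₂_add₂ {d : D.Tot} {b : B.Tot} (h : π₂ d = b) : add₂ (D.zero₂ b) d = d := by
  subst h
  apply ident_inj
  rw [ident_add₂, ident_zero₂]
  exact tzero_tadd (D.ident d)

end Algebra

section Core

variable {D}

theorem exists_coreIncl_eq {m : M} {d : D.Tot} (h₁ : π₁ d = tzero A m) (h₂ : π₂ d = tzero B m) :
    ∃ c : D.coreFib m, D.coreIncl c = d := by
  obtain ⟨a, x⟩ := d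
  obtain rfl : a = tzero A m := h₁
  exact ⟨⟨x, h₂⟩, rfl⟩

theorem exists_addCore_eq {d : D.Tot} {a : A.Tot} (ha : π₁ d = a) (h : π₂ d = tzero B a.proj) :
    ∃ c : D.coreFib a.proj, D.addCore a c = d := by
  subst ha
  have hz : π₂ (smul₂ (-1) (D.zero₁ (π₁ d))) = π₂ d := by
    rw [D.π₂_smul₂, D.π₂_zero₁, h]
  obtain ⟨c, hc⟩ : ∃ c, D.coreIncl c = add₂ d (smul₂ (-1) (D.zero₁ (π₁ d))) := by
    refine exists_coreIncl_eq ?_ ((D.π₂_add₂ _ _).trans h)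
    rw [D.π₁_add₂ _ _ hz.symm, D.π₁_smul₂, D.π₁_zero₁, tadd_tsmul_neg_one]
  refine ⟨c, ident_inj ?_⟩
  rw [addCore, hc, ident_add₂, ident_add₂, ident_smul₂]
  exact tadd_tadd_tsmul_neg_one (h.trans (D.π₂_zero₁ _).symm)

theorem exists_add₁_addCore_eq {d d' : D.Tot} (h₁ : π₁ d = π₁ d') (h₂ : π₂ d = π₂ d') :
    ∃ c : D.coreFib (π₁ d').proj, add₁ d' (D.addCore (π₁ d') c) = d := by
  have he : π₂ (add₁ d (smul₁ (-1) d')) = tzero B (π₁ d').proj := by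
    rw [D.π₂_add₁ _ _ (h₁.trans (D.π₁_smul₁ _ _).symm), π₂_smul₁, h₂, tadd_tsmul_neg_one,
      D.square]
  obtain ⟨c, hc⟩ := exists_addCore_eq ((D.π₁_add₁ _ _).trans h₁) he
  exact ⟨c, (congrArg (add₁ d') hc).trans (tadd_tadd_tsmul_neg_one (V := D.over₁) h₁)⟩

theorem π₂_addCore (a : A.Tot) (c : D.coreFib a.proj) : π₂ (D.addCore a c) = tzero B a.proj :=
  (D.π₂_add₂ _ _).trans (D.π₂_zero₁ a)

theorem π₂_add₁_addCore (d : D.Tot) (c : D.coreFib (π₁ d).proj) :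
    π₂ (add₁ d (D.addCore (π₁ d) c)) = π₂ d := by
  rw [D.π₂_add₁ _ _ (D.π₁_addCore _ c).symm, π₂_addCore, D.square, tadd_tzero]

theorem add₂_coreIncl {m : M} (c c' : D.coreFib m) :
    add₂ (D.coreIncl c) (D.coreIncl c') = D.coreIncl (c + c') := by
  have h₁ (x : D.coreFib m) : π₁ (D.coreIncl x) = tzero A m := rfl
  have h₂ (x : D.coreFib m) : π₂ (D.coreIncl x) = tzero B m := x.2
  have hz : π₂ (D.zero₁ (tzero A m)) = tzero B m := D.π₂_zero₁ _
  have h := D.interchange (D.coreIncl c) (D.zero₁ (tzero A m)) (D.zero₁ (tzero A m))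
    (D.coreIncl c') rfl rfl ((h₂ c).trans hz.symm) (hz.trans (h₂ c').symm)
  rw [add₁_zero₁ (h₁ c), zero₁_add₁ (h₁ c'), zero₁_tzero, add₂_zero₂ (h₂ c),
    zero₂_add₂ (h₂ c')] at h
  exact h.trans (tadd_mk _ _ _)

end Core

section Smoothness

/-- The model of the manifold `D`. -/
abbrev model := ((𝓡 n).prod 𝓘(ℝ, A.F)).prod 𝓘(ℝ, D.over₁.F)

theorem contMDiff_zero₂ : ContMDiff ((𝓡 n).prod 𝓘(ℝ, B.F)) D.model ∞ D.zero₂ :=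
  D.ident.symm.contMDiff.comp (contMDiff_tzero D.over₂)

theorem contMDiff_smul₂ : ContMDiff (𝓘(ℝ, ℝ).prod D.model) D.model ∞
    (fun p : ℝ × D.Tot => smul₂ p.1 p.2) :=
  D.ident.symm.contMDiff.comp (D.over₂.contMDiff_tsmul.comp
    (contMDiff_fst.prodMk (D.ident.contMDiff.comp contMDiff_snd)))

variable {D}

theorem contMDiff_linFun_symm (s : D.over₁.dual.Sec) :
    ContMDiff (((𝓡 n).prod 𝓘(ℝ, B.F)).prod 𝓘(ℝ, D.over₂.F)) 𝓘(ℝ, ℝ) ∞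
      (fun x => linFun s (D.ident.symm x)) :=
  (linFun_contMDiff s).comp D.ident.symm.contMDiff

theorem linFun_smul₂_coreIncl {m : M} (c : D.coreFib m) (s : D.over₁.dual.Sec) (t : ℝ) :
    linFun s (smul₂ t (D.coreIncl c)) = t * linFun s (D.coreIncl c) := by
  have hcore (t : ℝ) : ∃ c' : D.coreFib m, D.coreIncl c' = smul₂ t (D.coreIncl c) :=
    exists_coreIncl_eq ((D.π₁_smul₂ t _).trans (tsmul_tzero t m)) ((D.π₂_smul₂ t _).trans c.2)
  let φ : ℝ →+ ℝ := AddMonoidHom.mk' (fun t => linFun s (smul₂ t (D.coreIncl c))) fun a b => by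
    obtain ⟨ca, ha⟩ := hcore a
    obtain ⟨cb, hb⟩ := hcore b
    rw [add_smul₂, ← ha, ← hb, add₂_coreIncl]
    exact map_add (s (tzero A m)) ca.1 cb.1
  have hφ : Continuous φ := (linFun_contMDiff s).continuous.comp
    (D.contMDiff_smul₂.continuous.comp (continuous_id.prodMk continuous_const))
  calc φ t = φ (t • 1) := by rw [smul_eq_mul, mul_one]
    _ = t * φ 1 := map_real_smul φ hφ t 1
    _ = t * linFun s (D.coreIncl c) := congrArg (fun d => t * linFun s d) (D.one_smul₂ _)

/-- The section `b ↦ s (0_b)` of the dual of `B`. -/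
def onZero₂ (s : D.over₁.dual.Sec) : B.dual.Sec :=
  secOfHomogeneous ((linFun_contMDiff s).comp D.contMDiff_zero₂) fun t b => by
    simp only [Function.comp_apply, zero₂_tsmul]
    exact linFun_tsmul s t _

end Smoothness

section LinearSections

variable {D} {χ : D.over₁.dual.Sec}

theorem ev_pt_of_π₁_eq (χ : D.over₁.dual.Sec) {a : A.Tot} {d : D.Tot} (h : π₁ d = a) :
    ev (pt χ a) d = linFun χ d := by
  subst h
  exact ev_pt χ d

theorem IsLinearSection.linFun_smul₂ (hχ : D.IsLinearSection χ) (t : ℝ) (d : D.Tot) :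
    linFun χ (smul₂ t d) = t * linFun χ d := by
  have h := (hχ.smul t (π₁ d)).2 d rfl
  rwa [ev_pt_of_π₁_eq χ (D.π₁_smul₂ t d), ev_pt_of_π₁_eq χ rfl] at h

theorem linFun_add₂_of_homogeneous (hχ : ∀ t (d : D.Tot), linFun χ (smul₂ t d) = t * linFun χ d)
    {d d' : D.Tot} (h : π₂ d = π₂ d') : linFun χ (add₂ d d') = linFun χ d + linFun χ d' := by
  have hs (t : ℝ) (x : D.over₂.Tot) :
      linFun χ (D.ident.symm (tsmul t x)) = t * linFun χ (D.ident.symm x) := by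
    simpa only [smul₂, D.ident.apply_symm_apply] using hχ t (D.ident.symm x)
  simpa only [linFun_secOfHomogeneous, ← ident_add₂, D.ident.symm_apply_apply] using
    linFun_tadd (secOfHomogeneous (contMDiff_linFun_symm χ) hs) (D.ident d) (D.ident d') h

theorem isLinearSection_iff :
    D.IsLinearSection χ ↔ ∀ t (d : D.Tot), linFun χ (smul₂ t d) = t * linFun χ d := by
  refine ⟨fun h => h.linFun_smul₂, fun h => ⟨⟨fun m => D.dualProj (pt χ (tzero A m)), fun a => ?_⟩,
    fun a a' _ => ⟨rfl, fun d₁ d₂ h₁ h₂ h₃ => ?_⟩, fun t a => ⟨rfl, fun d hd => ?_⟩⟩⟩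
  · have hcore (a : A.Tot) (c : D.coreFib a.proj) :
        ev (pt χ a) (D.addCore a c) = linFun χ (D.coreIncl c) := by
      rw [ev_pt_of_π₁_eq χ (D.π₁_addCore a c), addCore,
        linFun_add₂_of_homogeneous h (D.π₂_zero_core a c)]
      exact (congrArg (· + _) (linFun_tzero χ a)).trans (zero_add _)
    ext c
    exact (hcore a c).trans (hcore (tzero A a.proj) c).symm
  · replace h₁ : π₁ d₁ = a := h₁
    replace h₂ : π₁ d₂ = a' := h₂
    have h₄ : π₁ (add₂ d₁ d₂) = tadd a a' := (D.π₁_add₂ _ _ h₃).trans (congrArg₂ tadd h₁ h₂)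
    rw [ev_pt_of_π₁_eq χ h₄, ev_pt_of_π₁_eq χ h₁, ev_pt_of_π₁_eq χ h₂,
      linFun_add₂_of_homogeneous h h₃]
  · replace hd : π₁ d = a := hd
    have h₁ : π₁ (smul₂ t d) = tsmul t a := (D.π₁_smul₂ t d).trans (congrArg (tsmul t) hd)
    rw [ev_pt_of_π₁_eq χ h₁, ev_pt_of_π₁_eq χ hd, h]

namespace IsLinearSection

variable (hχ : D.IsLinearSection χ)

include hχ

theorem linFun_zero₂ (b : B.Tot) : linFun χ (D.zero₂ b) = 0 := by
  have h := hχ.linFun_smul₂ 0 (D.zero₂ b)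
  rwa [smul₂_zero, π₂_zero₂, zero_mul] at h

theorem linFun_add₁_addCore (d : D.Tot) (c : D.coreFib (π₁ d).proj) :
    linFun χ (add₁ d (D.addCore (π₁ d) c)) = linFun χ d + linFun χ (D.coreIncl c) := by
  have h₁ : linFun χ (D.zero₁ (π₁ d)) = 0 := linFun_tzero χ _
  have h₂ := linFun_add₂_of_homogeneous hχ.linFun_smul₂ (D.π₂_zero_core _ c)
  rw [h₁, zero_add] at h₂
  exact (linFun_tadd χ d _ (D.π₁_addCore _ c).symm).trans (congrArg (_ + ·) h₂)

end IsLinearSection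

theorem exists_coreIncl_linFun_eq {m : M} {x : D.Tot} (hx : π₁ x = tzero A m) :
    ∃ c : D.coreFib m, ∀ χ : D.over₁.dual.Sec, D.IsLinearSection χ →
      linFun χ (D.coreIncl c) = linFun χ x := by
  have hb : (π₂ x).proj = m := (D.square x).symm.trans (congrArg TotalSpace.proj hx)
  have hz : π₁ x = π₁ (smul₁ (-1) (D.zero₂ (π₂ x))) := by rw [π₁_smul₁, π₁_zero₂, hb, hx]
  have he : π₂ (add₁ x (smul₁ (-1) (D.zero₂ (π₂ x)))) = tzero B m := by
    rw [D.π₂_add₁ _ _ hz, π₂_smul₁, π₂_zero₂, tadd_tsmul_neg_one, hb]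
  obtain ⟨c, hc⟩ := exists_coreIncl_eq ((D.π₁_add₁ _ _).trans hx) he
  refine ⟨c, fun χ hχ => ?_⟩
  calc linFun χ (D.coreIncl c) = linFun χ x + linFun χ (smul₁ (-1) (D.zero₂ (π₂ x))) :=
        (congrArg (linFun χ) hc).trans (linFun_tadd χ _ _ hz)
    _ = linFun χ x + -1 * linFun χ (D.zero₂ (π₂ x)) := congrArg (_ + ·) (linFun_tsmul χ _ _)
    _ = linFun χ x := by rw [hχ.linFun_zero₂, mul_zero, add_zero]

end LinearSections

section Linearization

variable {D} [IsManifold (𝓡 n) ∞ M]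

/-- The derivative of `s` at zero along the fibres of `D → B`. Both scalar multiplications of `D`
commute, so this is again a section of the dual of `D → A`, and it is linear. -/
def linearization (s : D.over₁.dual.Sec) : D.over₁.dual.Sec :=
  secOfHomogeneous
    ((linFun_contMDiff (fibreDeriv (contMDiff_linFun_symm s))).comp D.ident.contMDiff)
    fun r d => by
      have hd (d : D.Tot) := hasDerivAt_fibreDeriv (contMDiff_linFun_symm s) (D.ident d)
      refine (hd _).unique (((hd d).const_mul r).congr_of_eventuallyEq (.of_forall fun t => ?_))
      exact (congrArg (linFun s) (D.smul₂_smul₁ t r d)).trans (linFun_tsmul s r _)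

variable (s : D.over₁.dual.Sec)

theorem hasDerivAt_linearization (d : D.Tot) :
    HasDerivAt (fun t : ℝ => linFun s (smul₂ t d)) (linFun (linearization s) d) 0 :=
  hasDerivAt_fibreDeriv (contMDiff_linFun_symm s) (D.ident d)

theorem isLinearSection_linearization : D.IsLinearSection (linearization s) :=
  isLinearSection_iff.2 fun t d => by
    simp only [linearization, linFun_secOfHomogeneous, Function.comp_apply, ident_smul₂,
      linFun_tsmul]

variable {s}

theorem linFun_linearization_eq {d : D.Tot} (h : ∀ t, linFun s (smul₂ t d) = t * linFun s d) :
    linFun (linearization s) d = linFun s d :=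
  (hasDerivAt_linearization s d).unique <| by
    simp only [h]
    simpa using (hasDerivAt_id (0 : ℝ)).mul_const (linFun s d)

theorem hasDerivAt_linFun_smul_smul₂ (f : C^∞⟮(𝓡 n).prod 𝓘(ℝ, A.F), A.Tot; ℝ⟯)
    (s : D.over₁.dual.Sec) (d : D.Tot) :
    HasDerivAt (fun t : ℝ => linFun (f • s) (smul₂ t d))
      (f (tzero A (π₁ d).proj) * linFun (linearization s) d +
        linFun (fibreDeriv f.contMDiff) (π₁ d) * linFun (onZero₂ s) (π₂ d)) 0 := by
  have h := (hasDerivAt_fibreDeriv f.contMDiff (π₁ d)).mul (hasDerivAt_linearization s d)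
  rw [zero_tsmul, smul₂_zero] at h
  convert! h using 1
  · funext t
    exact congrArg (f · * _) (D.π₁_smul₂ t d)
  · exact add_comm _ _

/-- The Leibniz rule for the linearization of a cut-off frame expansion `ρ² χ = ∑ fᵢ gᵢ` gives the
two kinds of generators: one with the coefficient `fᵢ (0)`, the other with the fibre derivative of
`fᵢ` at zero. -/
theorem exists_linearSection_generators [T2Space M] (D : DoubleVectorBundle A B) (m : M) :
    ∃ (k : ℕ) (ρ : C^∞⟮𝓡 n, M; ℝ⟯) (g : Fin k → D.over₁.dual.Sec)
      (v : Fin k → D.over₁.Fib (tzero A m)), ρ m = 1 ∧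
        ∀ χ : D.over₁.dual.Sec, D.IsLinearSection χ →
          ∃ (h : Fin k → C^∞⟮𝓡 n, M; ℝ⟯) (σ : Fin k → A.dual.Sec),
            (∀ i, h i m = linFun χ ⟨tzero A m, v i⟩) ∧
            ∀ d : D.Tot, ρ (π₁ d).proj * ρ (π₁ d).proj * linFun χ d =
              ∑ i, (h i (π₁ d).proj * linFun (linearization (g i)) d +
                linFun (σ i) (π₁ d) * linFun (onZero₂ (g i)) (π₂ d)) := by
  obtain ⟨k, ρ, g, s, hρ, hg⟩ := D.over₁.exists_dual_generators (tzero A m)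
  let z : C^∞⟮𝓡 n, M; (𝓡 n).prod 𝓘(ℝ, A.F), A.Tot⟯ := ⟨tzero A, contMDiff_tzero A⟩
  refine ⟨k, ρ.comp z, g, fun i => s i (tzero A m), hρ, fun χ hχ =>
    ⟨fun i => (pairing χ (s i)).comp z, fun i => fibreDeriv (pairing χ (s i)).contMDiff,
      fun i => rfl, fun d => ?_⟩⟩
  have hl := hasDerivAt_linFun_smul_smul₂ (ρ * ρ) χ d
  have hr := HasDerivAt.fun_sum (u := Finset.univ)
    fun i _ => hasDerivAt_linFun_smul_smul₂ (pairing χ (s i)) (g i) d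
  simp only [← linFun_sum, ← hg χ] at hr
  have h₀ : linFun (onZero₂ χ) (π₂ d) = 0 := hχ.linFun_zero₂ _
  rw [linFun_linearization_eq fun t => hχ.linFun_smul₂ t d, h₀, mul_zero, add_zero] at hl
  exact hl.unique hr

end Linearization

section Surjectivity

variable {D}

/-- The projection to `B` of the fibre of `D → A` over `a`. -/
def fibProj₂ (D : DoubleVectorBundle A B) (a : A.Tot) : Submodule ℝ (B.Fib a.proj) where
  carrier := {b | ∃ d : D.Tot, π₁ d = a ∧ π₂ d = ⟨a.proj, b⟩}
  add_mem' := by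
    rintro x y ⟨d, hd, hd'⟩ ⟨e, he, he'⟩
    refine ⟨add₁ d e, (D.π₁_add₁ d e).trans hd, ?_⟩
    rw [D.π₂_add₁ _ _ (hd.trans he.symm), hd', he', tadd_mk]
  zero_mem' := ⟨D.zero₁ a, rfl, D.π₂_zero₁ a⟩
  smul_mem' := by
    rintro t x ⟨d, hd, hd'⟩
    exact ⟨smul₁ t d, hd, by rw [D.π₂_smul₁, hd']; rfl⟩

theorem exists_mem_fibProj₂_eq_π₂ {a : A.Tot} {d : D.Tot} {t : ℝ} (ht : t ≠ 0)
    (hd : π₁ d = tsmul t a) : ∃ b ∈ D.fibProj₂ a, π₂ d = ⟨a.proj, b⟩ := by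
  have h₁ : π₁ (smul₂ t⁻¹ d) = a := by
    rw [D.π₁_smul₂, hd, tsmul_tsmul, inv_mul_cancel₀ ht, one_tsmul]
  have h₂ : (π₂ d).proj = a.proj := by rw [← D.square, hd, tsmul_proj]
  obtain ⟨b, hb⟩ : ∃ b, π₂ d = ⟨a.proj, b⟩ := by
    rw [← h₂]
    exact ⟨(π₂ d).2, rfl⟩
  exact ⟨b, ⟨_, h₁, (D.π₂_smul₂ _ _).trans hb⟩, hb⟩

variable [IsManifold (𝓡 n) ∞ M] [T2Space M]

/-- A point `b` outside the projection of the fibre over `a` is separated from it by a form `τ`. The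
fibres over `t a` with `t ≠ 0` have the same projection, so `τ` vanishes on a section of `D → A`
through `0_b` along the line `t a`, except at `t = 0`: a contradiction. -/
theorem fibProj₂_eq_top (a : A.Tot) : D.fibProj₂ a = ⊤ := by
  by_contra htop
  obtain ⟨b, -, hb⟩ := SetLike.exists_of_lt (lt_top_iff_ne_top.2 htop)
  obtain ⟨φ, hφb, hφ⟩ := (D.fibProj₂ a).exists_le_ker_of_notMem hb
  obtain ⟨τ, -, hτ⟩ := exists_apply_eq_of_separating (V := B) ⊤ a.proj (fun x hx =>
    (TotalSpace.mk_inj (b := a.proj)).1 (eq_of_linFun_eq (y := tzero B a.proj) rfl fun s =>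
      (hx s trivial).trans (linFun_tzero s _).symm)) φ
  obtain ⟨σ, hσ⟩ := exists_sec_through (D.zero₂ ⟨a.proj, b⟩)
  rw [show (D.zero₂ ⟨a.proj, b⟩).proj = tsmul 0 a from
    (D.π₁_zero₂ _).trans (zero_tsmul a).symm] at hσ
  let γ : ℝ → ℝ := fun t => linFun τ (π₂ (D := D.toDoubleBundle) (pt σ (tsmul t a)))
  have hγ : Continuous γ :=
    (linFun_contMDiff τ).continuous.comp <| D.proj₂.smooth.continuous.comp <|
      (contMDiff_pt σ).continuous.comp <|
        A.contMDiff_tsmul.continuous.comp (continuous_id.prodMk continuous_const)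
  have hγt : ∀ t ∈ ({0}ᶜ : Set ℝ), γ t = 0 := fun t ht => by
    obtain ⟨b', hb', h⟩ := exists_mem_fibProj₂_eq_π₂ (d := pt σ (tsmul t a)) ht rfl
    exact (congrArg (linFun τ) h).trans ((hτ b').trans (hφ hb'))
  have hγ₀ : γ 0 = φ b := by
    rw [← hτ b, ← D.π₂_zero₂ ⟨a.proj, b⟩, ← hσ]
  exact hφb (hγ₀.symm.trans (congrFun
    (hγ.ext_on (dense_compl_singleton (0 : ℝ)) continuous_const hγt) 0))

theorem exists_π₁_eq_π₂_eq {a : A.Tot} {b : B.Tot} (h : a.proj = b.proj) :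
    ∃ d : D.Tot, π₁ d = a ∧ π₂ d = b := by
  obtain ⟨m, b⟩ := b
  obtain rfl : a.proj = m := h
  have hb : b ∈ D.fibProj₂ a := fibProj₂_eq_top (D := D) a ▸ Submodule.mem_top
  exact hb

end Surjectivity

end DoubleVectorBundle

namespace InvolutiveDVB

open DoubleVectorBundle

variable {n : ℕ} {M : Type u} [TopologicalSpace M] [ChartedSpace (EuclideanSpace ℝ (Fin n)) M]
  {Q : SmoothVB (𝓡 n) M} {D : InvolutiveDVB Q}

section Involution

theorem inv_smul₁ (t : ℝ) (d : D.Tot) : D.inv (smul₁ t d) = smul₂ t (D.inv d) :=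
  ident_inj ((D.inv₁₂.map_smul t d).trans (ident_smul₂ t (D.inv d)).symm)

theorem inv_smul₂ (t : ℝ) (d : D.Tot) : D.inv (smul₂ t d) = smul₁ t (D.inv d) := by
  rw [← D.inv_inv (smul₁ t (D.inv d)), inv_smul₁, D.inv_inv]

variable (D) in
theorem contMDiff_inv : ContMDiff D.model D.model ∞ D.inv := by
  simpa only [Function.comp_def, D.ident.symm_apply_apply] using
    D.ident.symm.contMDiff.comp D.inv₁₂.smooth

theorem mem_isotropicSections_iff {χ : D.dualE.Sec} :
    χ ∈ D.isotropicSections ↔ ∀ d, linFun χ (D.inv d) = -linFun χ d := by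
  refine ⟨fun hχ d => ?_, fun hχ => ⟨isLinearSection_iff.2 fun t d => ?_,
    fun q q' _ d h₁ h₂ => ?_⟩⟩
  · have h := hχ.2 (π₁ d) (π₂ d) (D.square d) d rfl rfl
    rw [ev_pt_of_π₁_eq χ rfl, ev_pt_of_π₁_eq χ (D.π₁_inv d)] at h
    linarith
  · calc linFun χ (smul₂ t d) = -linFun χ (smul₁ t (D.inv d)) := by
          rw [← inv_smul₂, hχ, neg_neg]
      _ = -(t * linFun χ (D.inv d)) := congrArg Neg.neg (linFun_tsmul χ t (D.inv d))
      _ = t * linFun χ d := by rw [hχ, mul_neg, neg_neg]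
  · replace h₁ : π₁ d = q := h₁
    replace h₂ : π₂ d = q' := h₂
    rw [ev_pt_of_π₁_eq χ h₁, ev_pt_of_π₁_eq χ ((D.π₁_inv d).trans h₂), hχ, add_neg_cancel]

end Involution

section IsotropicSections

theorem isotropicSections_ext {χ χ' : D.isotropicSections}
    (h : ∀ d : D.Tot, linFun χ.1 d = linFun χ'.1 d) : χ = χ' :=
  Subtype.ext (dual_ext h)

/-- Evaluation at the point `d`, as a functional on the linear isotropic sections. -/
def isotropicEval (d : D.Tot) : D.isotropicSections →+ ℝ :=
  (evalHom (V := D.over₁) d).comp D.isotropicSections.subtype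

theorem linFun_inv (χ : D.isotropicSections) (d : D.Tot) :
    linFun χ.1 (D.inv d) = -linFun χ.1 d :=
  mem_isotropicSections_iff.1 χ.2 d

theorem linFun_smul (f : C^∞⟮𝓡 n, M; ℝ⟯) (χ : D.isotropicSections) (d : D.Tot) :
    linFun (f • χ).1 d = f (π₁ d).proj * linFun χ.1 d := rfl

theorem linFun_sum_smul_add_wedge {k : ℕ} (h : Fin k → C^∞⟮𝓡 n, M; ℝ⟯)
    (ξ : Fin k → D.isotropicSections) (σ τ : Fin k → Q.dual.Sec) (d : D.Tot) :
    linFun (∑ i, (h i • ξ i + D.wedge (σ i) (τ i))).1 d =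
      ∑ i, (h i (π₁ d).proj * linFun (ξ i).1 d + wedgeForm (σ i) (τ i) (π₁ d) (π₂ d)) :=
  map_sum (isotropicEval d) _ _

variable [IsManifold (𝓡 n) ∞ M]

/-- The skew-symmetrisation of the linearization of `s`. -/
def isotropicPart (s : D.dualE.Sec) : D.isotropicSections :=
  ⟨secOfHomogeneous (V := D.over₁)
      (g := fun d => 2⁻¹ * (linFun (linearization s) d - linFun (linearization s) (D.inv d)))
      (contMDiff_const.mul ((linFun_contMDiff _).sub ((linFun_contMDiff _).comp D.contMDiff_inv)))
      fun t d => by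
        have h₁ : linFun (linearization s) (tsmul t d) = t * linFun (linearization s) d :=
          linFun_tsmul _ t d
        have h₂ := (isLinearSection_linearization s).linFun_smul₂ t (D.inv d)
        rw [← inv_smul₁] at h₂
        rw [h₁, mul_left_comm, mul_sub t, ← h₂]
        rfl,
    mem_isotropicSections_iff.2 fun d => by
      simp only [linFun_secOfHomogeneous, D.inv_inv]
      ring⟩

theorem linFun_isotropicPart (s : D.dualE.Sec) (d : D.Tot) : linFun (isotropicPart s).1 d =
    2⁻¹ * (linFun (linearization s) d - linFun (linearization s) (D.inv d)) := rfl

theorem linFun_isotropicPart_coreIncl (s : D.dualE.Sec) {m : M} (c : D.coreFib m) :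
    linFun (isotropicPart s).1 (D.coreIncl c) = linFun s (D.coreIncl c) := by
  have hlin (c : D.coreFib m) : linFun (linearization s) (D.coreIncl c) = linFun s (D.coreIncl c) :=
    linFun_linearization_eq (linFun_smul₂_coreIncl c s)
  have hneg : linFun s (D.coreIncl (-c)) = -linFun s (D.coreIncl c) :=
    map_neg (s (tzero Q m)) c.1
  rw [linFun_isotropicPart, D.inv_core, hlin, hlin, hneg]
  ring

variable [T2Space M]

theorem eq_of_linFun_isotropic_eq {d d' : D.Tot} (h₁ : π₁ d = π₁ d') (h₂ : π₂ d = π₂ d')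
    (h : ∀ χ : D.isotropicSections, linFun χ.1 d = linFun χ.1 d') : d = d' := by
  obtain ⟨c, rfl⟩ := exists_add₁_addCore_eq h₁ h₂
  have hc : D.coreIncl c = D.coreIncl 0 := eq_of_linFun_eq (V := D.over₁) rfl fun s => by
    have hs := (isotropicPart s).2.1.linFun_add₁_addCore d' c
    rw [h, linFun_isotropicPart_coreIncl] at hs
    exact (left_eq_add.1 hs).trans (linFun_tzero s _).symm
  have h₀ : D.addCore (π₁ d') c = D.zero₁ (π₁ d') := by
    rw [addCore, hc]
    exact (congrArg (add₂ _) (D.zero₁_tzero _)).trans (add₂_zero₂ (D.π₂_zero₁ _))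
  rw [h₀]
  exact add₁_zero₁ rfl

variable (D) in
theorem exists_isotropic_generators (m : M) :
    ∃ (k : ℕ) (ρ : C^∞⟮𝓡 n, M; ℝ⟯) (ξ : Fin k → D.isotropicSections)
      (v : Fin k → D.over₁.Fib (tzero Q m)), ρ m = 1 ∧ ∀ χ : D.isotropicSections,
        ∃ (h : Fin k → C^∞⟮𝓡 n, M; ℝ⟯) (σ τ : Fin k → Q.dual.Sec),
          (∀ i, h i m = linFun χ.1 ⟨tzero Q m, v i⟩) ∧
          ρ • ρ • χ = ∑ i, (h i • ξ i + D.wedge (σ i) (τ i)) := by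
  have hgen := exists_linearSection_generators D.toDoubleVectorBundle m
  obtain ⟨k, ρ, g, v, hρ, hg⟩ := hgen
  refine ⟨k, ρ, fun i => isotropicPart (g i), v, hρ, fun χ => ?_⟩
  have hχ := hg χ.1 χ.2.1
  obtain ⟨h, σ, hh, hσ⟩ := hχ
  refine ⟨h, σ, fun i => onZero₂ (g i), hh, isotropicSections_ext fun d => ?_⟩
  have hinv := hσ (D.inv d)
  simp only [D.π₁_inv, D.π₂_inv, ← D.square d] at hinv
  calc linFun (ρ • ρ • χ).1 d
      = 2⁻¹ * (ρ (π₁ d).proj * ρ (π₁ d).proj * linFun χ.1 d -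
          ρ (π₁ d).proj * ρ (π₁ d).proj * linFun χ.1 (D.inv d)) := by
        rw [linFun_smul, linFun_smul, linFun_inv]
        ring
    _ = ∑ i, (h i (π₁ d).proj * linFun (isotropicPart (g i)).1 d +
          wedgeForm (σ i) (onZero₂ (g i)) (π₁ d) (π₂ d)) := by
        rw [hσ d, hinv, ← Finset.sum_sub_distrib, Finset.mul_sum]
        refine Finset.sum_congr rfl fun i _ => ?_
        rw [linFun_isotropicPart, wedgeForm]
        ring
    _ = _ := (linFun_sum_smul_add_wedge h _ σ _ d).symm

theorem exists_over_zero_eq_linFun (m : M) (Λ : D.isotropicSections →+ ℝ)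
    (hΛ : ∀ (f : C^∞⟮𝓡 n, M; ℝ⟯) χ, Λ (f • χ) = f m * Λ χ)
    (hw : ∀ τ₁ τ₂, Λ (D.wedge τ₁ τ₂) = 0) :
    ∃ x : D.Tot, π₁ x = tzero Q m ∧ ∀ χ : D.isotropicSections, linFun χ.1 x = Λ χ := by
  have hgen := D.exists_isotropic_generators m
  obtain ⟨k, ρ, ξ, v, hρ, hg⟩ := hgen
  have hcancel (r : ℝ) : ρ m * (ρ m * r) = r := by rw [hρ, one_mul, one_mul]
  refine ⟨⟨tzero Q m, ∑ i, Λ (ξ i) • v i⟩, rfl, fun χ => ?_⟩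
  have hχ := hg χ
  obtain ⟨h, σ, τ, hh, hsum⟩ := hχ
  calc linFun χ.1 ⟨tzero Q m, ∑ i, Λ (ξ i) • v i⟩ = ∑ i, Λ (ξ i) * h i m := by
        simp only [linFun_sum_smul, hh]
    _ = Λ (∑ i, (h i • ξ i + D.wedge (σ i) (τ i))) := by
        simp only [map_sum, map_add, hΛ, hw, add_zero, mul_comm]
    _ = Λ (ρ • ρ • χ) := congrArg Λ hsum.symm
    _ = ρ m * (ρ m * Λ χ) := (hΛ ρ _).trans (congrArg _ (hΛ ρ χ))
    _ = Λ χ := hcancel _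

theorem exists_core_eq_linFun (m : M) (Λ : D.isotropicSections →+ ℝ)
    (hΛ : ∀ (f : C^∞⟮𝓡 n, M; ℝ⟯) χ, Λ (f • χ) = f m * Λ χ)
    (hw : ∀ τ₁ τ₂, Λ (D.wedge τ₁ τ₂) = 0) :
    ∃ c : D.coreFib m, ∀ χ : D.isotropicSections, linFun χ.1 (D.coreIncl c) = Λ χ := by
  have hpoint := exists_over_zero_eq_linFun m Λ hΛ hw
  obtain ⟨x, hx, hxΛ⟩ := hpoint
  obtain ⟨c, hc⟩ := exists_coreIncl_linFun_eq hx
  exact ⟨c, fun χ => (hc χ.1 χ.2.1).trans (hxΛ χ)⟩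

theorem exists_point_eq_linFun {a b : Q.Tot} (hab : a.proj = b.proj)
    (Λ : D.isotropicSections →+ ℝ) (hΛ : ∀ (f : C^∞⟮𝓡 n, M; ℝ⟯) χ, Λ (f • χ) = f a.proj * Λ χ)
    (hw : ∀ τ₁ τ₂, Λ (D.wedge τ₁ τ₂) = wedgeForm τ₁ τ₂ a b) :
    ∃ d : D.Tot, π₁ d = a ∧ π₂ d = b ∧ ∀ χ : D.isotropicSections, linFun χ.1 d = Λ χ := by
  have hd := exists_π₁_eq_π₂_eq (D := D.toDoubleVectorBundle) hab
  obtain ⟨d, rfl, rfl⟩ := hd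
  have hcore := exists_core_eq_linFun (π₁ d).proj (Λ - isotropicEval d)
    (fun f χ => (congrArg (fun r : ℝ => r - f (π₁ d).proj * linFun χ.1 d) (hΛ f χ)).trans
      (mul_sub _ _ _).symm)
    (fun τ₁ τ₂ => sub_eq_zero.2 (hw τ₁ τ₂))
  obtain ⟨c, hc⟩ := hcore
  refine ⟨add₁ d (D.addCore (π₁ d) c), D.π₁_add₁ _ _, π₂_add₁_addCore d c, fun χ => ?_⟩
  rw [χ.2.1.linFun_add₁_addCore, hc]
  exact add_sub_cancel _ _

end IsotropicSections

end InvolutiveDVB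

variable {n₁ n₂ : ℕ}
  {M₁ : Type u} [TopologicalSpace M₁] [ChartedSpace (EuclideanSpace ℝ (Fin n₁)) M₁]
  {M₂ : Type v} [TopologicalSpace M₂] [ChartedSpace (EuclideanSpace ℝ (Fin n₂)) M₂]
  {Q₁ : SmoothVB (𝓡 n₁) M₁} {Q₂ : SmoothVB (𝓡 n₂) M₂}
  {D₁ : InvolutiveDVB Q₁} {D₂ : InvolutiveDVB Q₂}

namespace IDVBHom

variable (Ω : IDVBHom D₁ D₂)

theorem π₁_toFun (d : D₁.Tot) : π₁ (Ω.toFun d) = Ω.sideA (π₁ d) := Ω.over₁.proj d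

theorem π₂_toFun (d : D₁.Tot) : π₂ (Ω.toFun d) = Ω.sideA (π₂ d) := by
  rw [← D₂.π₁_inv, ← Ω.comm_inv, π₁_toFun, D₁.π₁_inv]

theorem sideB_eq_sideA : Ω.sideB = Ω.sideA := funext fun q =>
  calc Ω.sideB q = π₂ (Ω.toFun (D₁.zero₂ q)) := (Ω.over₂.proj (tzero D₁.over₂ q)).symm
    _ = Ω.sideA q := by rw [π₂_toFun, D₁.π₂_zero₂]

/-- The base map `ω₀`, as a smooth map. -/
def baseMap : C^∞⟮𝓡 n₁, M₁; 𝓡 n₂, M₂⟯ := ⟨Ω.base, Ω.overA.smooth_base⟩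

/-- The map `ω^⋆` of linear isotropic sections. -/
def pullC : D₂.isotropicSections →ₛₗ[pullbackFun Ω.baseMap] D₁.isotropicSections where
  toFun χ := ⟨Ω.over₁.pullback χ.1, InvolutiveDVB.mem_isotropicSections_iff.2 fun d =>
    (congrArg (linFun χ.1) (Ω.comm_inv d)).trans (InvolutiveDVB.linFun_inv χ _)⟩
  map_add' _ _ := InvolutiveDVB.isotropicSections_ext fun _ => rfl
  map_smul' f χ := InvolutiveDVB.isotropicSections_ext fun d => by
    have hbase : (π₁ (Ω.toFun d)).proj = Ω.base (π₁ d).proj :=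
      (congrArg TotalSpace.proj (Ω.π₁_toFun d)).trans (Ω.overA.proj _)
    exact congrArg (fun m => f m * linFun χ.1 (Ω.toFun d)) hbase

/-- The map `ω_Q^⋆` of sections of the duals of the sides. -/
def pullQ : Q₂.dual.Sec →ₛₗ[pullbackFun Ω.baseMap] Q₁.dual.Sec where
  toFun := Ω.overA.pullback
  map_add' _ _ := dual_ext fun _ => rfl
  map_smul' f τ := dual_ext fun q =>
    congrArg (fun m => f m * linFun τ (Ω.sideA q)) (Ω.overA.proj q)

/-- The triple `(ω₀, ω^⋆, ω_Q^⋆)` that is induced by `Ω`. -/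
def toPair : ModuleMorphismPair D₁ D₂ where
  base := Ω.baseMap
  mapC := Ω.pullC
  mapQ := Ω.pullQ
  map_wedge τ₁ τ₂ := InvolutiveDVB.isotropicSections_ext fun d =>
    congrArg₂ (InvolutiveDVB.wedgeForm τ₁ τ₂) (Ω.π₁_toFun d) (Ω.π₂_toFun d)

theorem induces_toPair : Ω.Induces Ω.toPair := ⟨fun _ => rfl, fun _ _ => rfl, fun _ _ => rfl⟩

variable {Ω} in
theorem Induces.unique {T T' : ModuleMorphismPair D₁ D₂} (h : Ω.Induces T) (h' : Ω.Induces T') :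
    T = T' := by
  obtain ⟨b, c, q, w⟩ := T
  obtain ⟨b', c', q', w'⟩ := T'
  obtain rfl : b = b' := ContMDiffMap.ext fun m => (h.base m).trans (h'.base m).symm
  obtain rfl : c = c' := LinearMap.ext fun χ => InvolutiveDVB.isotropicSections_ext fun d =>
    (h.mapC χ d).trans (h'.mapC χ d).symm
  obtain rfl : q = q' := LinearMap.ext fun τ => dual_ext fun x =>
    (h.mapQ τ x).trans (h'.mapQ τ x).symm
  rfl

variable {Ω} {Ω' : IDVBHom D₁ D₂}

theorem ext_of_toFun_eq (hfun : Ω.toFun = Ω'.toFun) (hside : Ω.sideA = Ω'.sideA)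
    (hbase : Ω.base = Ω'.base) : Ω = Ω' := by
  have hB : Ω.sideB = Ω'.sideB := by rw [Ω.sideB_eq_sideA, Ω'.sideB_eq_sideA, hside]
  obtain ⟨⟨f, a, b, m, _, _, _, _⟩, _⟩ := Ω
  obtain ⟨⟨f', a', b', m', _, _, _, _⟩, _⟩ := Ω'
  obtain rfl : f = f' := hfun
  obtain rfl : a = a' := hside
  obtain rfl : b = b' := hB
  obtain rfl : m = m' := hbase
  rfl

theorem Induces.hom_unique [IsManifold (𝓡 n₂) ∞ M₂] [T2Space M₂]
    {T : ModuleMorphismPair D₁ D₂} (h : Ω.Induces T) (h' : Ω'.Induces T) : Ω = Ω' := by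
  have hbase : Ω.base = Ω'.base := funext fun m => (h.base m).symm.trans (h'.base m)
  have hside : Ω.sideA = Ω'.sideA := funext fun q =>
    eq_of_linFun_eq (by rw [Ω.overA.proj, Ω'.overA.proj, hbase])
      fun τ => (h.mapQ τ q).symm.trans (h'.mapQ τ q)
  refine ext_of_toFun_eq (funext fun d => ?_) hside hbase
  refine InvolutiveDVB.eq_of_linFun_isotropic_eq ?_ ?_
    fun χ => (h.mapC χ d).symm.trans (h'.mapC χ d)
  · rw [Ω.π₁_toFun, Ω'.π₁_toFun, hside]
  · rw [Ω.π₂_toFun, Ω'.π₂_toFun, hside]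

end IDVBHom

namespace ModuleMorphismPair

variable [IsManifold (𝓡 n₂) ∞ M₂] [T2Space M₂] (T : ModuleMorphismPair D₁ D₂)

theorem exists_side (q : Q₁.Tot) : ∃ x : Q₂.Tot, x.proj = T.base q.proj ∧
    ∀ τ, linFun τ x = linFun (T.mapQ τ) q :=
  exists_eq_linFun (T.base q.proj) ((evalHom q).comp T.mapQ.toAddMonoidHom)
    fun f τ => congrArg (evalHom q) (T.mapQ.map_smulₛₗ f τ)

/-- The map `ω_Q` that is determined by `ω_Q^⋆`. -/
def side (q : Q₁.Tot) : Q₂.Tot := (T.exists_side q).choose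

theorem side_proj (q : Q₁.Tot) : (T.side q).proj = T.base q.proj := (T.exists_side q).choose_spec.1

theorem linFun_side (τ : Q₂.dual.Sec) (q : Q₁.Tot) : linFun τ (T.side q) = linFun (T.mapQ τ) q :=
  (T.exists_side q).choose_spec.2 τ

theorem isVBMorphism_side : IsVBMorphism Q₁ Q₂ T.side T.base :=
  .of_separating Set.univ (fun _ _ h hxy => eq_of_linFun_eq h fun τ => hxy τ (Set.mem_univ τ))
    T.base.contMDiff T.side_proj fun τ _ => ⟨T.mapQ τ, T.linFun_side τ⟩

theorem linFun_mapC_smul (f : C^∞⟮𝓡 n₂, M₂; ℝ⟯) (χ : D₂.isotropicSections) (d : D₁.Tot) :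
    linFun (T.mapC (f • χ)).1 d = f (T.side (π₁ d)).proj * linFun (T.mapC χ).1 d := by
  have hmap : linFun (T.mapC (f • χ)).1 d = f (T.base (π₁ d).proj) * linFun (T.mapC χ).1 d :=
    congrArg (InvolutiveDVB.isotropicEval d) (T.mapC.map_smulₛₗ f χ)
  exact hmap.trans (congrArg (fun m => f m * linFun (T.mapC χ).1 d) (T.side_proj (π₁ d)).symm)

theorem linFun_mapC_wedge (τ₁ τ₂ : Q₂.dual.Sec) (d : D₁.Tot) :
    linFun (T.mapC (D₂.wedge τ₁ τ₂)).1 d =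
      InvolutiveDVB.wedgeForm τ₁ τ₂ (T.side (π₁ d)) (T.side (π₂ d)) := by
  simp only [InvolutiveDVB.wedgeForm, linFun_side]
  exact congrArg (InvolutiveDVB.isotropicEval d) (T.map_wedge τ₁ τ₂)

theorem side_π₁_proj (d : D₁.Tot) : (T.side (π₁ d)).proj = (T.side (π₂ d)).proj :=
  (T.side_proj _).trans ((congrArg T.base (D₁.square d)).trans (T.side_proj _).symm)

theorem exists_total (d : D₁.Tot) : ∃ e : D₂.Tot, π₁ e = T.side (π₁ d) ∧ π₂ e = T.side (π₂ d) ∧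
    ∀ χ : D₂.isotropicSections, linFun χ.1 e = linFun (T.mapC χ).1 d :=
  InvolutiveDVB.exists_point_eq_linFun (T.side_π₁_proj d)
    ((InvolutiveDVB.isotropicEval d).comp T.mapC.toAddMonoidHom)
    (fun f χ => T.linFun_mapC_smul f χ d) (fun τ₁ τ₂ => T.linFun_mapC_wedge τ₁ τ₂ d)

/-- The map `Ω` that is determined by `ω^⋆` and `ω_Q`. -/
def total (d : D₁.Tot) : D₂.Tot := (T.exists_total d).choose

theorem π₁_total (d : D₁.Tot) : π₁ (T.total d) = T.side (π₁ d) := (T.exists_total d).choose_spec.1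

theorem π₂_total (d : D₁.Tot) : π₂ (T.total d) = T.side (π₂ d) :=
  (T.exists_total d).choose_spec.2.1

theorem linFun_total (χ : D₂.isotropicSections) (d : D₁.Tot) :
    linFun χ.1 (T.total d) = linFun (T.mapC χ).1 d := (T.exists_total d).choose_spec.2.2 χ

theorem total_inv (d : D₁.Tot) : T.total (D₁.inv d) = D₂.inv (T.total d) := by
  refine InvolutiveDVB.eq_of_linFun_isotropic_eq ?_ ?_ fun χ => ?_
  · rw [π₁_total, D₁.π₁_inv, D₂.π₁_inv, π₂_total]
  · rw [π₂_total, D₁.π₂_inv, D₂.π₂_inv, π₁_total]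
  · rw [linFun_total, InvolutiveDVB.linFun_inv, InvolutiveDVB.linFun_inv, linFun_total]

theorem isVBMorphism_total : IsVBMorphism D₁.over₁ D₂.over₁ T.total T.side := by
  refine .of_separating (D₂.isotropicSections ∪ Set.range D₂.proj₂.pullback)
    (fun d d' h hd => ?_) T.isVBMorphism_side.smooth T.π₁_total ?_
  · refine InvolutiveDVB.eq_of_linFun_isotropic_eq h ?_ fun χ => hd _ (.inl χ.2)
    refine eq_of_linFun_eq ?_ fun τ => hd _ (.inr ⟨τ, rfl⟩)
    rw [← D₂.square, ← D₂.square]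
    exact congrArg TotalSpace.proj h
  · rintro _ (hχ | ⟨τ, rfl⟩)
    · exact ⟨_, T.linFun_total ⟨_, hχ⟩⟩
    · refine ⟨D₁.proj₂.pullback (T.mapQ τ), fun d => ?_⟩
      exact (congrArg (linFun τ) (T.π₂_total d)).trans (T.linFun_side τ _)

theorem isVBMorphism_total₂ : IsVBMorphism D₁.over₂ D₂.over₂
    (fun x => D₂.ident (T.total (D₁.ident.symm x))) T.side := by
  have h := D₂.inv₁₂.comp (T.isVBMorphism_total.comp D₁.inv₂₁)
  simpa only [Function.comp_def, id_eq, total_inv, D₂.inv_inv] using h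

/-- The morphism that is determined by `(ω₀, ω^⋆, ω_Q^⋆)`. -/
def toHom : IDVBHom D₁ D₂ where
  toFun := T.total
  sideA := T.side
  sideB := T.side
  base := T.base
  over₁ := T.isVBMorphism_total
  over₂ := T.isVBMorphism_total₂
  overA := T.isVBMorphism_side
  overB := T.isVBMorphism_side
  comm_inv := T.total_inv

theorem induces_toHom : T.toHom.Induces T :=
  ⟨fun _ => rfl, fun χ d => (T.linFun_total χ d).symm, fun τ q => (T.linFun_side τ q).symm⟩

end ModuleMorphismPair

end

theorem theorem3p14_general {n₁ n₂ : ℕ}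
    {M₁ : Type u} [TopologicalSpace M₁] [ChartedSpace (EuclideanSpace ℝ (Fin n₁)) M₁]
    {M₂ : Type v} [TopologicalSpace M₂] [ChartedSpace (EuclideanSpace ℝ (Fin n₂)) M₂]
    [IsManifold (𝓡 n₂) ∞ M₂] [T2Space M₂]
    {Q₁ : SmoothVB (𝓡 n₁) M₁} {Q₂ : SmoothVB (𝓡 n₂) M₂}
    (D₁ : InvolutiveDVB Q₁) (D₂ : InvolutiveDVB Q₂) :
    (∀ Ω : IDVBHom D₁ D₂, ∃! T : ModuleMorphismPair D₁ D₂, Ω.Induces T) ∧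
      (∀ T : ModuleMorphismPair D₁ D₂, ∃! Ω : IDVBHom D₁ D₂, Ω.Induces T) :=
  ⟨fun Ω => ⟨Ω.toPair, Ω.induces_toPair, fun _ hT => hT.unique Ω.induces_toPair⟩,
    fun T => ⟨T.toHom, T.induces_toHom, fun _ hΩ => hΩ.hom_unique T.induces_toHom⟩⟩

/-- A morphism of involutive double vector bundles is equivalent to a pair of module morphisms over a
smooth map that is compatible with the wedge product: every morphism `Ω` induces exactly one such
pair, and every such pair is induced by exactly one `Ω`. -/
theorem theorem3p14 {n₁ n₂ : ℕ}
    {M₁ : Type u} [TopologicalSpace M₁] [ChartedSpace (EuclideanSpace ℝ (Fin n₁)) M₁]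
    [IsManifold (𝓡 n₁) ∞ M₁] [T2Space M₁] [SecondCountableTopology M₁]
    {M₂ : Type v} [TopologicalSpace M₂] [ChartedSpace (EuclideanSpace ℝ (Fin n₂)) M₂]
    [IsManifold (𝓡 n₂) ∞ M₂] [T2Space M₂] [SecondCountableTopology M₂]
    {Q₁ : SmoothVB (𝓡 n₁) M₁} {Q₂ : SmoothVB (𝓡 n₂) M₂}
    (D₁ : InvolutiveDVB Q₁) (D₂ : InvolutiveDVB Q₂) :
    (∀ Ω : IDVBHom D₁ D₂, ∃! T : ModuleMorphismPair D₁ D₂, Ω.Induces T) ∧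
      (∀ T : ModuleMorphismPair D₁ D₂, ∃! Ω : IDVBHom D₁ D₂, Ω.Induces T) :=
  theorem3p14_general D₁ D₂
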